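/- **Setting.** Let $X\in\mathbb R^d$ have a probability density $f$ under $P$, let $g:\mathbb R^d\to\mathbb R$, $\mathcal E=\mathcal E(\gamma)=\{x: g(x)\ge\gamma\}$ (closed) and $p=p(\gamma)=P(X\in\mathcal E)$. Let $\mu(x)=\log E e^{x^TX}\in(-\infty,\infty]$, $I(y)=\sup_x\{x^Ty-\mu(x)\}$, $\mathcal D(\mu)=\{\mu<\infty\}$, $\mathcal D(I)=\{I<\infty\}$. Conditions on $\gamma$ below are meant for all sufficiently large $\gamma$. **Conventions.** A quantity $q(\gamma)$ *grows at most subexponentially in* $-\log p$ if for every $\varepsilon>0$ we have $q\le e^{\varepsilon(-\log p)}$ for all large $\gamma$; it *decays exponentially in* $-\log p$ if $q\le Ce^{-c(-\log p)}$ for all large $\gamma$, for some constants $C,c>0$; and for positive $q_1,q_2$, $q_1\sim q_2$ means $\log(q_1/q_2)/(-\log p)\to0$ as $\gamma\to\infty$. A sample size $n=n(\gamma)$ is *subexponential in* $-\log p$ if $\log n/(-\log p)\to 0$. **Assumptions.** (A1) $\mu$ is a closed proper convex function, $0\in\mathcal D(\mu)^\circ$, $\mu$ is strictly convex and differentiable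 on $\mathcal D(\mu)^\circ$, and $\|\nabla\mu(x_m)\|_2\to\infty$ for every sequence $(x_m)$ in $\mathcal D(\mu)^\circ$ converging to a boundary point of $\mathcal D(\mu)$. (Then for $y\in\mathcal D(I)^\circ$ there is a unique $s_y\in\mathcal D(\mu)^\circ$ with $\nabla\mu(s_y)=y$.) (A2) $p\to0$ as $\gamma\to\infty$, and $0<\inf_{x\in\mathcal E}I(x)<\infty$. There is a dominating set $A=\{a_1,\dots,a_r\}\subset\mathcal E\cap\mathcal D(I)^\circ$ with $r=r(\gamma)$ distinct points (depending on $\gamma$), $I(a_1)\le\dots\le I(a_r)$; that is, for every $x\in\mathcal E$ there is $a\in A$ with $s_a^T(x-a)\ge0$, and for no $a\in A$ does $A\setminus\{a\}$ have this property. Moreover $r$ grows at most subexponentially in $-\log p$. Let $k=k(\gamma)$ with $1\le k\le r$, and put $\mathcal E_1=\mathcal E\cap\bigcup_{i=1}^k\{x: s_{a_i}^T(x-a_i)\ge0\}$, $\mathcal E_2=\mathcal E\setminus\mathcal E_1$, $p_j=P(X\in\mathcal E_j)$, with the convention $I(a_{k+1})=\infty$ if $k=r$. Let $\tilde P$ be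 the importance sampling distribution with density $$\tilde f(x)=f(x)\sum_{i=1}^k\frac1k e^{s_{a_i}^Tx-\mu(s_{a_i})}.$$ (A3) $p_1\sim e^{-I(a_1)}$; $p_2\le h\,e^{-I(a_{k+1})}$ for some $h=h(\gamma)$ growing at most subexponentially in $-\log p$; and $e^{I(a_1)-I(a_{k+1})}$ decays exponentially in $-\log p$. (A4) $\tilde P(X\in\mathcal E_2)$ decays exponentially in $-\log p$. **Theorem (Constructing confidence intervals with probabilistically efficient estimators).** Assume (A1)–(A4). Let $Z=I_{\mathcal E}(X)f(X)/\tilde f(X)$ and $Z_1=I_{\mathcal E_1}(X)f(X)/\tilde f(X)$, and denote by $\widetilde{\mathrm{Var}}$ the variance under $\tilde P$. 1. There is a sample size $n=n(\gamma)\ge2$, subexponential in $-\log p$, such that $\widetilde{\mathrm{Var}}(Z_1)/(np_1^2)\to0$ as $\gamma\to\infty$. 2. For every such $n$, let $X_1,\dots,X_n$ be i.i.d. from $\tilde P$, let $\mathbf Z=(Z^{(1)},\dots,Z^{(n)})$ with $Z^{(i)}=I_{\mathcal E}(X_i)f(X_i)/\tilde f(X_i)$, and let $\hat p$ and $V_n(\mathbf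 Z)$ be the sample mean and the (unbiased) sample variance of the $Z^{(i)}$. Then for every $0<\alpha<1$, $$\limsup_{\gamma\to\infty}\tilde P\left(|\hat p-p|>\sqrt{\frac{2V_n(\mathbf Z)\log(4/\alpha)}{n}}+\frac{7\log(4/\alpha)\,k\,e^{-I(a_1)}}{3(n-1)}\right)\le\alpha,$$ that is, $\hat p\pm\Big(\sqrt{2V_n(\mathbf Z)\log(4/\alpha)/n}+\frac{7\log(4/\alpha)ke^{-I(a_1)}}{3(n-1)}\Big)$ is an asymptotically valid $(1-\alpha)$-level confidence interval for $p$. -/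

import Mathlib

open Filter Topology MeasureTheory ProbabilityTheory

noncomputable section

namespace RareEvent

variable {d : ℕ}

/-- The space `ℝ^d` with the Euclidean norm and inner product. -/
abbrev Space (d : ℕ) : Type := EuclideanSpace ℝ (Fin d)

/-- The distribution on `ℝ^d` with Lebesgue density `h`. -/
def densityLaw (h : Space d → ℝ) : Measure (Space d) :=
  volume.withDensity fun x => ENNReal.ofReal (h x)

/-- `f` is a probability density function on `ℝ^d`. -/
structure IsDensity (f : Space d → ℝ) : Prop where
  measurable : Measurable f
  nonneg : ∀ x, 0 ≤ f x
  isProbabilityMeasure : IsProbabilityMeasure (densityLaw f)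

/-- The cumulant generating function `μ(x) = log E exp(xᵀX)`, with value `⊤` where the expectation
is infinite. -/
def cumulant (f : Space d → ℝ) (x : Space d) : EReal :=
  ENNReal.log (∫⁻ y, ENNReal.ofReal (Real.exp (inner ℝ x y)) ∂(densityLaw f))

/-- The real-valued version of the cumulant generating function; it is only used where `μ` is
finite. -/
def cumulantReal (f : Space d → ℝ) (x : Space d) : ℝ := (cumulant f x).toReal

/-- `D(μ) = {x : μ(x) < ∞}`. -/
def cumulantDom (f : Space d → ℝ) : Set (Space d) := {x | cumulant f x < ⊤}

/-- The rate function `I(y) = sup_x (xᵀy - μ(x))`. -/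
def rate (f : Space d → ℝ) (y : Space d) : EReal :=
  ⨆ x : Space d, ((inner ℝ x y : ℝ) : EReal) - cumulant f x

/-- `D(I) = {y : I(y) < ∞}`. -/
def rateDom (f : Space d → ℝ) : Set (Space d) := {y | rate f y < ⊤}

/-- The regularity conditions on the cumulant generating function. -/
structure RegularCumulant (f : Space d → ℝ) : Prop where
  /-- `μ` is convex (convex epigraph) -/
  convex : Convex ℝ {q : Space d × ℝ | cumulant f q.1 ≤ (q.2 : EReal)}
  /-- `μ` is closed -/
  closed : LowerSemicontinuous (cumulant f)
  /-- `μ` is proper -/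
  proper : (∀ x, cumulant f x ≠ ⊥) ∧ ∃ x, cumulant f x ≠ ⊤
  zero_mem : (0 : Space d) ∈ interior (cumulantDom f)
  strictConvex : StrictConvexOn ℝ (interior (cumulantDom f)) (cumulantReal f)
  differentiable : DifferentiableOn ℝ (cumulantReal f) (interior (cumulantDom f))
  steep : ∀ (u : ℕ → Space d) (b : Space d), (∀ m, u m ∈ interior (cumulantDom f)) →
    b ∈ frontier (cumulantDom f) → Tendsto u atTop (𝓝 b) →
    Tendsto (fun m => ‖gradient (cumulantReal f) (u m)‖) atTop atTop

/-- `s_y`: the point `s` in the interior of `D(μ)` with `∇μ(s) = y`. Under the regularity conditions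
on `μ`, it exists and is unique for all `y` in the interior of `D(I)`. -/
def tilt (f : Space d → ℝ) (y : Space d) : Space d :=
  Function.invFunOn (gradient (cumulantReal f)) (interior (cumulantDom f)) y

/-- The half-space `{x : s_aᵀ(x - a) ≥ 0}`. -/
def halfSpace (f : Space d → ℝ) (a : Space d) : Set (Space d) :=
  {x | 0 ≤ (inner ℝ (tilt f a) (x - a) : ℝ)}

/-- `A` is a dominating set for `E` associated with the density `f`. The points of `A` lie in the
interior of `D(I)`, where `s_a` is defined. -/
structure IsDominatingSet (f : Space d → ℝ) (E A : Set (Space d)) : Prop where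
  subset : A ⊆ E
  subset_interior : A ⊆ interior (rateDom f)
  cover : ∀ x ∈ E, ∃ a ∈ A, x ∈ halfSpace f a
  minimal : ∀ a ∈ A, ¬ ∀ x ∈ E, ∃ b ∈ A \ {a}, x ∈ halfSpace f b

/-- The rare-event set `E(γ) = {x : g(x) ≥ γ}`. -/
def rareSet (g : Space d → ℝ) (γ : ℝ) : Set (Space d) := {x | γ ≤ g x}

/-- The target probability `p(γ) = P(X ∈ E(γ))`. -/
def prob (f g : Space d → ℝ) (γ : ℝ) : ℝ := (densityLaw f).real (rareSet g γ)

/-- `q` grows at most subexponentially in `-log p`. -/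
def AtMostSubexp (q p : ℝ → ℝ) : Prop :=
  ∀ ε > 0, ∀ᶠ γ in atTop, q γ ≤ Real.exp (ε * (-Real.log (p γ)))

/-- `q` decays exponentially in `-log p`. -/
def ExpDecay (q p : ℝ → ℝ) : Prop :=
  ∃ C > 0, ∃ c > 0, ∀ᶠ γ in atTop, q γ ≤ C * Real.exp (-c * (-Real.log (p γ)))

/-- `q₁ ∼ q₂`: the quotient `q₁ / q₂` of positive quantities grows or decays at most subexponentially
in `-log p`. -/
def LogEquiv (q₁ q₂ p : ℝ → ℝ) : Prop :=
  (∀ᶠ γ in atTop, 0 < q₁ γ ∧ 0 < q₂ γ) ∧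
    Tendsto (fun γ => Real.log (q₁ γ / q₂ γ) / (-Real.log (p γ))) atTop (𝓝 0)

/-- `e^{-u}` for an extended real number `u > -∞`, with `e^{-∞} = 0`. -/
def expNeg (u : EReal) : ℝ := (EReal.exp (-u)).toReal

/-- The basic assumptions on the estimation problem. The points `a γ 1, …, a γ (r γ)` are the
dominating points `a₁, …, a_r`; other values of `a γ` play no role. -/
structure ProblemAssumption (f g : Space d → ℝ) (r : ℝ → ℕ) (a : ℝ → ℕ → Space d) : Prop where
  closed : ∀ᶠ γ in atTop, IsClosed (rareSet g γ)
  rare : Tendsto (prob f g) atTop (𝓝 0)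
  regular : RegularCumulant f
  rate_inf : ∀ᶠ γ in atTop,
    0 < (⨅ x ∈ rareSet g γ, rate f x) ∧ (⨅ x ∈ rareSet g γ, rate f x) < ⊤
  dominating : ∀ᶠ γ in atTop, IsDominatingSet f (rareSet g γ) (a γ '' Set.Icc 1 (r γ))
  distinct : ∀ᶠ γ in atTop, Set.InjOn (a γ) (Set.Icc 1 (r γ))
  ordered : ∀ᶠ γ in atTop, ∀ i j, 1 ≤ i → i ≤ j → j ≤ r γ → rate f (a γ i) ≤ rate f (a γ j)
  subexp : AtMostSubexp (fun γ => (r γ : ℝ)) (prob f g)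

/-- `E₁`: the part of `E(γ)` covered by the half-spaces of the first `k γ` dominating points. -/
def coveredSet (f g : Space d → ℝ) (k : ℝ → ℕ) (a : ℝ → ℕ → Space d) (γ : ℝ) : Set (Space d) :=
  rareSet g γ ∩ ⋃ i ∈ Finset.Icc 1 (k γ), halfSpace f (a γ i)

/-- `E₂ = E(γ) \ E₁`. -/
def missedSet (f g : Space d → ℝ) (k : ℝ → ℕ) (a : ℝ → ℕ → Space d) (γ : ℝ) : Set (Space d) :=
  rareSet g γ \ coveredSet f g k a γ

/-- `p₁ = P(X ∈ E₁)`. -/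
def coveredProb (f g : Space d → ℝ) (k : ℝ → ℕ) (a : ℝ → ℕ → Space d) (γ : ℝ) : ℝ :=
  (densityLaw f).real (coveredSet f g k a γ)

/-- `p₂ = P(X ∈ E₂)`. -/
def missedProb (f g : Space d → ℝ) (k : ℝ → ℕ) (a : ℝ → ℕ → Space d) (γ : ℝ) : ℝ :=
  (densityLaw f).real (missedSet f g k a γ)

/-- `I(a_{k+1})`, which is `∞` if `k = r`. -/
def nextRate (f : Space d → ℝ) (r k : ℝ → ℕ) (a : ℝ → ℕ → Space d) (γ : ℝ) : EReal :=
  if k γ < r γ then rate f (a γ (k γ + 1)) else ⊤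

/-- The assumption that `p₁ ∼ e^{-I(a₁)}` and that `p₂` is negligible. -/
structure NegligibleAssumption (f g : Space d → ℝ) (r k : ℝ → ℕ) (a : ℝ → ℕ → Space d) :
    Prop where
  covered : LogEquiv (coveredProb f g k a) (fun γ => expNeg (rate f (a γ 1))) (prob f g)
  missed : ∃ h : ℝ → ℝ, AtMostSubexp h (prob f g) ∧
    ∀ᶠ γ in atTop, missedProb f g k a γ ≤ h γ * expNeg (nextRate f r k a γ)
  gap : ExpDecay (fun γ => expNeg (nextRate f r k a γ - rate f (a γ 1))) (prob f g)

/-- The importance sampling density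
`f̃(x) = f(x) ∑_{i=1}^k (1/k) exp(s_{a_i}ᵀ x - μ(s_{a_i}))`. -/
def tiltedDensity (f : Space d → ℝ) (k : ℝ → ℕ) (a : ℝ → ℕ → Space d) (γ : ℝ) (x : Space d) : ℝ :=
  f x * ∑ i ∈ Finset.Icc 1 (k γ), 1 / (k γ : ℝ) *
    Real.exp (inner ℝ (tilt f (a γ i)) x - cumulantReal f (tilt f (a γ i)))

/-- The importance sampling distribution `P̃` of `X`. -/
def tiltedLaw (f : Space d → ℝ) (k : ℝ → ℕ) (a : ℝ → ℕ → Space d) (γ : ℝ) : Measure (Space d) :=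
  densityLaw (tiltedDensity f k a γ)

/-- The assumption that `P̃(X ∈ E₂)` decays exponentially in `-log p`. -/
def MissedTiltedDecay (f g : Space d → ℝ) (k : ℝ → ℕ) (a : ℝ → ℕ → Space d) : Prop :=
  ExpDecay (fun γ => (tiltedLaw f k a γ).real (missedSet f g k a γ)) (prob f g)

/-- The importance sampling output `Z` as a function of the sample point:
`Z = I_E(x) f(x) / f̃(x)`. -/
def output (f g : Space d → ℝ) (k : ℝ → ℕ) (a : ℝ → ℕ → Space d) (γ : ℝ) : Space d → ℝ :=
  (rareSet g γ).indicator fun x => f x / tiltedDensity f k a γ x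

/-- The output `Z₁ = I_{E₁}(x) f(x) / f̃(x)`. -/
def coveredOutput (f g : Space d → ℝ) (k : ℝ → ℕ) (a : ℝ → ℕ → Space d) (γ : ℝ) : Space d → ℝ :=
  (coveredSet f g k a γ).indicator fun x => f x / tiltedDensity f k a γ x

/-- The sample size `n` (at least two, so that the sample variance makes sense) is subexponential
in `-log p`, and `Var̃(Z₁) / (n p₁²) → 0`. -/
structure AdmissibleSampleSize (f g : Space d → ℝ) (k : ℝ → ℕ) (a : ℝ → ℕ → Space d)
    (n : ℝ → ℕ) : Prop where
  two_le : ∀ᶠ γ in atTop, 2 ≤ n γ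
  subexp : Tendsto (fun γ => Real.log (n γ) / (-Real.log (prob f g γ))) atTop (𝓝 0)
  relative_variance : Tendsto (fun γ => ProbabilityTheory.variance (coveredOutput f g k a γ) (tiltedLaw f k a γ) /
    (n γ * coveredProb f g k a γ ^ 2)) atTop (𝓝 0)

/-- The sample mean. -/
def sampleMean {n : ℕ} (z : Fin n → ℝ) : ℝ := (∑ i, z i) / n

/-- The (unbiased) sample variance `V_n`. -/
def sampleVariance {n : ℕ} (z : Fin n → ℝ) : ℝ := (∑ i, (z i - sampleMean z) ^ 2) / (n - 1)

/-- The half-width `√(2 V_n(Z) log(4/α) / n) + 7 log(4/α) k e^{-I(a₁)} / (3 (n - 1))`, where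
`I₁ = I(a₁)`. -/
def halfWidth (k : ℕ) (I₁ : EReal) (α : ℝ) {n : ℕ} (z : Fin n → ℝ) : ℝ :=
  √(2 * sampleVariance z * Real.log (4 / α) / n) +
    7 * Real.log (4 / α) * k * expNeg I₁ / (3 * (n - 1))

end RareEvent

end

open RareEvent

/-!
The likelihood ratio `f / f̃` is at most `B = k exp (-I(a₁))` on `E₁`: each point of `E₁` lies in the
half-space of some `aᵢ` with `i ≤ k`, where the exponent of the `i`-th exponential tilt is at least
`I(aᵢ) ≥ I(a₁)` (`coveredOutput_le`). Hence `Z₁` takes values in `[0, B]`, has mean `p₁` and variance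
at most `B²`. Since `k` and `exp (-I(a₁)) / p₁` are subexponential in `-log p`, the sample size
`n ≈ (B / p₁)² (-log p)` is subexponential and makes the relative variance vanish
(`exists_admissibleSampleSize`).

The estimate on `f / f̃` needs the tilting points: for `y` in the interior of the domain of the rate
function, `μ - ⟪·, y⟫` is coercive and attains its minimum, and steepness of `μ` excludes a minimum
on the boundary of the domain. At the interior minimizer `∇μ = y` and the supremum defining `I(y)` is
attained (`RegularCumulant.exists_gradient_eq`, `RegularCumulant.rate_eq`).

For the interval the main tool is the empirical Bernstein inequality of Maurer and Pontil
(`empirical_bernstein_pi`): for an independent sample of a law on `[0, B]` with mean `m` and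
`L ≥ 0`,
`|mean - m| ≤ √(2 V L / n) + 7 L B / (3 (n - 1))` outside an event of probability `3 exp (-L)`.
Two of the three summands `exp (-L)` come from Bernstein's inequality for the sample mean. The third
is for the event that the sample variance is much smaller than the variance
(`sampleVariance_lower_tail`): the sample variance is an average over permutations of averages of the
kernel `(x - y)² / 2` over disjoint, hence independent, pairs, and Jensen's inequality transfers the
Laplace transform bound of the latter to the former.

The inequality is applied to `Z₁` with `L = log (3 / α)`. As `L` is strictly smaller than
`log (4 / α)`, the half-width exceeds the bound by at least `7 log (4 / 3) B / (3 (n - 1))`, which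
eventually dominates the bias `p₂ = p - p₁` (`eventually_missedProb_le`). Finally `Z` and `Z₁` agree
on the sample unless it hits `E₂`, an event of probability at most `n P̃(X ∈ E₂) → 0`
(`tendsto_sampleSize_mul_missed`).
-/

namespace RareEvent

/-! ### Exponential inequalities -/

theorem exp_neg_le_quadratic {x : ℝ} (hx : 0 ≤ x) : Real.exp (-x) ≤ 1 - x + x ^ 2 / 2 := by
  have h := Real.quadratic_le_exp_of_nonneg hx
  rw [Real.exp_neg]
  refine inv_le_of_inv_le₀ (by nlinarith [sq_nonneg (x - 1)]) (le_trans ?_ h)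
  rw [inv_le_iff_one_le_mul₀ (by nlinarith [sq_nonneg (x - 1)])]
  nlinarith [sq_nonneg (x ^ 2)]

/-- The case `b = x` of Bernstein's bound for the exponential function, with denominators cleared;
the difference of the two sides has a nonnegative derivative for the same reason one degree lower. -/
theorem exp_mul_le_of_nonneg {x : ℝ} (hx : 0 ≤ x) :
    (6 - 2 * x) * Real.exp x ≤ 6 + 4 * x + x ^ 2 := by
  have h1 (y : ℝ) : (1 - y) * Real.exp y ≤ 1 := by
    have := Real.add_one_le_exp (-y)
    have h2 := mul_le_mul_of_nonneg_right this (Real.exp_pos y).le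
    rw [← Real.exp_add] at h2
    simp at h2
    linarith
  have h2 (y : ℝ) (hy : 0 ≤ y) : (4 - 2 * y) * Real.exp y ≤ 4 + 2 * y := by
    have hm : MonotoneOn (fun y : ℝ => 4 + 2 * y - (4 - 2 * y) * Real.exp y) (Set.Ici 0) := by
      have hd (z : ℝ) : HasDerivAt (fun y : ℝ => 4 + 2 * y - (4 - 2 * y) * Real.exp y)
          (2 - 2 * ((1 - z) * Real.exp z)) z := by
        have ha : HasDerivAt (fun y : ℝ => 2 * y) 2 z := by simpa using (hasDerivAt_id z).const_mul 2
        have := (ha.const_add 4).sub ((ha.const_sub 4).mul (Real.hasDerivAt_exp z))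
        refine this.congr_deriv ?_
        ring
      refine monotoneOn_of_deriv_nonneg (convex_Ici 0)
        (fun z _ => (hd z).continuousAt.continuousWithinAt)
        (fun z _ => (hd z).differentiableAt.differentiableWithinAt) fun z _ => ?_
      rw [(hd z).deriv]
      linarith [h1 z]
    have := hm Set.self_mem_Ici hy hy
    simp at this
    linarith
  have hm : MonotoneOn (fun y : ℝ => 6 + 4 * y + y ^ 2 - (6 - 2 * y) * Real.exp y) (Set.Ici 0) := by
    have hd (z : ℝ) : HasDerivAt (fun y : ℝ => 6 + 4 * y + y ^ 2 - (6 - 2 * y) * Real.exp y)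
        (4 + 2 * z - (4 - 2 * z) * Real.exp z) z := by
      have ha : HasDerivAt (fun y : ℝ => 2 * y) 2 z := by simpa using (hasDerivAt_id z).const_mul 2
      have hb : HasDerivAt (fun y : ℝ => 4 * y) 4 z := by simpa using (hasDerivAt_id z).const_mul 4
      have := ((hb.const_add 6).add (hasDerivAt_pow 2 z)).sub
        ((ha.const_sub 6).mul (Real.hasDerivAt_exp z))
      refine this.congr_deriv ?_
      norm_num
      ring
    refine monotoneOn_of_deriv_nonneg (convex_Ici 0)
      (fun z _ => (hd z).continuousAt.continuousWithinAt)
      (fun z _ => (hd z).differentiableAt.differentiableWithinAt) fun z hz => ?_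
    rw [(hd z).deriv]
    rw [interior_Ici] at hz
    linarith [h2 z (le_of_lt hz)]
  have := hm Set.self_mem_Ici hx hx
  simp at this
  linarith

/-- A quadratic bound with the constant that Bernstein's inequality requires. -/
theorem exp_le_bernstein {x b : ℝ} (hxb : x ≤ b) (hb : 0 ≤ b) (hb3 : b < 3) :
    Real.exp x ≤ 1 + x + x ^ 2 / (2 * (1 - b / 3)) := by
  have hden : 0 < 2 * (1 - b / 3) := by linarith
  rcases le_total x 0 with hx | hx
  · have h := exp_neg_le_quadratic (neg_nonneg.mpr hx)
    have : x ^ 2 / 2 ≤ x ^ 2 / (2 * (1 - b / 3)) :=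
      div_le_div_of_nonneg_left (sq_nonneg x) hden (by linarith)
    simp only [neg_neg, even_two, Even.neg_pow] at h
    linarith
  · have hx3 : 0 < 6 - 2 * x := by linarith
    have h1 : Real.exp x ≤ (6 + 4 * x + x ^ 2) / (6 - 2 * x) := by
      rw [le_div_iff₀ hx3, mul_comm]
      exact exp_mul_le_of_nonneg hx
    have h2 : (6 + 4 * x + x ^ 2) / (6 - 2 * x) = 1 + x + x ^ 2 / (2 * (1 - x / 3)) := by
      have : 2 * (1 - x / 3) = (6 - 2 * x) / 3 := by ring
      have h6 : 3 - x ≠ 0 := by linarith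
      rw [this, show 6 - 2 * x = 2 * (3 - x) by ring]
      field_simp
      ring
    have h3 : x ^ 2 / (2 * (1 - x / 3)) ≤ x ^ 2 / (2 * (1 - b / 3)) :=
      div_le_div_of_nonneg_left (sq_nonneg x) hden (by linarith)
    linarith

/-! ### Exponential moments and tails of independent sums -/

section Sums

variable {S : Type*} [MeasurableSpace S] {ν : Measure S} [IsProbabilityMeasure ν]

theorem integrable_of_ae_abs_le {φ : S → ℝ} (hφ : Measurable φ) {B : ℝ} (h : ∀ᵐ x ∂ν, |φ x| ≤ B) :
    Integrable φ ν :=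
  Integrable.of_bound hφ.aestronglyMeasurable B (by simpa using h)

theorem integral_exp_le_bernstein {φ : S → ℝ} (hφ : Measurable φ) {B lam : ℝ} (hB : 0 ≤ B)
    (h : ∀ᵐ x ∂ν, |φ x| ≤ B) (h0 : ∫ x, φ x ∂ν = 0) (hlam : 0 ≤ lam) (hlamB : lam * B < 3) :
    ∫ x, Real.exp (lam * φ x) ∂ν ≤
      Real.exp (lam ^ 2 * (∫ x, φ x ^ 2 ∂ν) / (2 * (1 - lam * B / 3))) := by
  have hi : Integrable φ ν := integrable_of_ae_abs_le hφ h
  have hi2 : Integrable (fun x => φ x ^ 2) ν := by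
    refine integrable_of_ae_abs_le (hφ.pow_const 2) (B := B ^ 2) ?_
    filter_upwards [h] with x hx
    rw [abs_pow]
    exact pow_le_pow_left₀ (abs_nonneg _) hx 2
  have hie : Integrable (fun x => Real.exp (lam * φ x)) ν := by
    refine integrable_of_ae_abs_le (hφ.const_mul lam).exp (B := Real.exp (lam * B)) ?_
    filter_upwards [h] with x hx
    rw [Real.abs_exp, Real.exp_le_exp]
    exact mul_le_mul_of_nonneg_left (le_of_abs_le hx) hlam
  calc ∫ x, Real.exp (lam * φ x) ∂ν
      ≤ ∫ x, (1 + lam * φ x + lam ^ 2 / (2 * (1 - lam * B / 3)) * φ x ^ 2) ∂ν := by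
        refine integral_mono_ae hie (((integrable_const 1).add (hi.const_mul lam)).add
          (hi2.const_mul _)) ?_
        filter_upwards [h] with x hx
        refine (exp_le_bernstein (mul_le_mul_of_nonneg_left (le_of_abs_le hx) hlam)
          (mul_nonneg hlam hB) hlamB).trans (le_of_eq ?_)
        ring
    _ = 1 + lam ^ 2 * (∫ x, φ x ^ 2 ∂ν) / (2 * (1 - lam * B / 3)) := by
        have hi1 : Integrable (fun x => 1 + lam * φ x) ν :=
          (integrable_const 1).add (hi.const_mul lam)
        rw [integral_add hi1 (hi2.const_mul _),
          integral_add (integrable_const 1) (hi.const_mul lam), integral_const_mul,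
          integral_const_mul, h0]
        simp
        ring
    _ ≤ _ := by linarith [Real.add_one_le_exp (lam ^ 2 * (∫ x, φ x ^ 2 ∂ν) / (2 * (1 - lam * B / 3)))]

/-- For nonnegative variables the lower tail is governed by the second moment alone, with no
dependence on the upper bound. -/
theorem integral_exp_neg_le {W : S → ℝ} (hW : Measurable W) {B θ : ℝ}
    (h : ∀ᵐ x ∂ν, |W x| ≤ B) (h0 : ∀ x, 0 ≤ W x) (hθ : 0 ≤ θ) :
    ∫ x, Real.exp (-(θ * W x)) ∂ν ≤
      Real.exp (-(θ * ∫ x, W x ∂ν) + θ ^ 2 * (∫ x, W x ^ 2 ∂ν) / 2) := by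
  have hi : Integrable W ν := integrable_of_ae_abs_le hW h
  have hi2 : Integrable (fun x => W x ^ 2) ν := by
    refine integrable_of_ae_abs_le (hW.pow_const 2) (B := B ^ 2) ?_
    filter_upwards [h] with x hx
    rw [abs_pow]
    exact pow_le_pow_left₀ (abs_nonneg _) hx 2
  have hie : Integrable (fun x => Real.exp (-(θ * W x))) ν := by
    refine integrable_of_ae_abs_le (hW.const_mul θ).neg.exp (B := 1) (Eventually.of_forall fun x => ?_)
    rw [Real.abs_exp, Real.exp_le_one_iff]
    have := mul_nonneg hθ (h0 x)
    linarith
  calc ∫ x, Real.exp (-(θ * W x)) ∂ν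
      ≤ ∫ x, (1 - θ * W x + θ ^ 2 / 2 * W x ^ 2) ∂ν := by
        refine integral_mono hie (((integrable_const 1).sub (hi.const_mul θ)).add
          (hi2.const_mul _)) fun x => ?_
        refine (exp_neg_le_quadratic (mul_nonneg hθ (h0 x))).trans (le_of_eq ?_)
        ring
    _ = 1 - θ * (∫ x, W x ∂ν) + θ ^ 2 * (∫ x, W x ^ 2 ∂ν) / 2 := by
        have hi1 : Integrable (fun x => 1 - θ * W x) ν :=
          (integrable_const 1).sub (hi.const_mul θ)
        rw [integral_add hi1 (hi2.const_mul _),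
          integral_sub (integrable_const 1) (hi.const_mul θ), integral_const_mul,
          integral_const_mul]
        simp
        ring
    _ ≤ _ := by
        linarith [Real.add_one_le_exp (-(θ * ∫ x, W x ∂ν) + θ ^ 2 * (∫ x, W x ^ 2 ∂ν) / 2)]

/-- Bernstein's inequality for an independent sample from `ν`. The exponent `L` of the tail
probability is the parameter, so that the deviation is the one in the confidence bound. -/
theorem bernstein_pi {φ : S → ℝ} (hφ : Measurable φ) {B L : ℝ} (hB : 0 ≤ B) (hL : 0 ≤ L)
    (h : ∀ᵐ x ∂ν, |φ x| ≤ B) (h0 : ∫ x, φ x ∂ν = 0) (hv : 0 < ∫ x, φ x ^ 2 ∂ν) {n : ℕ}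
    (hn : 0 < n) :
    (Measure.pi fun _ : Fin n => ν).real
      {z | √(2 * (n * ∫ x, φ x ^ 2 ∂ν) * L) + B / 3 * L ≤ ∑ i, φ (z i)} ≤ Real.exp (-L) := by
  set v : ℝ := n * ∫ x, φ x ^ 2 ∂ν with hv_def
  have hv' : 0 < v := by positivity
  -- The Cramér–Chernoff bound is optimal at `lam`.
  set s : ℝ := √(2 * L / v) with hs
  have hs0 : 0 ≤ s := Real.sqrt_nonneg _
  have hs2 : v * s ^ 2 = 2 * L := by
    rw [hs, Real.sq_sqrt (by positivity)]
    field_simp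
  set lam : ℝ := s / (1 + B / 3 * s) with hlam
  have hD : 0 < 1 + B / 3 * s := by positivity
  have hlam0 : 0 ≤ lam := by positivity
  have hlamB : 1 - lam * B / 3 = 1 / (1 + B / 3 * s) := by
    rw [hlam]; field_simp; ring
  have hlt : lam * B < 3 := by
    have : 0 < 1 - lam * B / 3 := by rw [hlamB]; positivity
    linarith
  have hsq : √(2 * v * L) = v * s := by
    rw [Real.sqrt_eq_iff_mul_self_eq (by positivity) (by positivity)]
    calc 2 * v * L = v * (v * s ^ 2) := by rw [hs2]; ring
      _ = v * s * (v * s) := by ring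
  have hint : ∫ z, Real.exp (lam * ∑ i, φ (z i)) ∂(Measure.pi fun _ : Fin n => ν) =
      (∫ x, Real.exp (lam * φ x) ∂ν) ^ n := by
    rw [← Fintype.card_fin n, ← integral_fintype_prod_eq_pow, Fintype.card_fin]
    refine integral_congr_ae (Eventually.of_forall fun z => ?_)
    simp only [Finset.mul_sum, Real.exp_sum]
  have hae : ∀ᵐ z ∂(Measure.pi fun _ : Fin n => ν), ∀ i, |φ (z i)| ≤ B := by
    rw [ae_all_iff]
    intro i
    exact (Measure.quasiMeasurePreserving_eval (fun _ : Fin n => ν) i).ae h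
  have hie : Integrable (fun z => Real.exp (lam * ∑ i, φ (z i)))
      (Measure.pi fun _ : Fin n => ν) := by
    refine integrable_of_ae_abs_le (B := Real.exp (lam * (n * B))) ?_ ?_
    · fun_prop
    · filter_upwards [hae] with z hz
      rw [Real.abs_exp, Real.exp_le_exp]
      refine mul_le_mul_of_nonneg_left ?_ hlam0
      refine (Finset.sum_le_sum fun i _ => le_of_abs_le (hz i)).trans (le_of_eq ?_)
      simp
  refine (measure_ge_le_exp_mul_mgf _ hlam0 hie).trans ?_
  rw [mgf, hint]
  have hb := integral_exp_le_bernstein hφ hB h h0 hlam0 hlt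
  have hb' := pow_le_pow_left₀ (integral_nonneg fun x => (Real.exp_pos _).le) hb n
  rw [← Real.exp_nat_mul] at hb'
  refine (mul_le_mul_of_nonneg_left hb' (Real.exp_pos _).le).trans ?_
  rw [← Real.exp_add, Real.exp_le_exp]
  refine le_of_eq ?_
  rw [hsq, hlamB]
  have e1 : (n : ℝ) * (lam ^ 2 * (∫ x, φ x ^ 2 ∂ν) / (2 * (1 / (1 + B / 3 * s)))) =
      lam ^ 2 * v * (1 + B / 3 * s) / 2 := by
    rw [hv_def]; field_simp
  rw [e1, hlam]
  have e2 : L = v * s ^ 2 / 2 := by linarith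
  rw [e2]
  field_simp
  ring

end Sums

/-! ### The sample variance as an average over permutations -/

/-- The average of a kernel over the images of two distinct indices under all permutations is its
average over all pairs of distinct indices. -/
theorem card_mul_sum_perm {n : ℕ} (F : Fin n → Fin n → ℝ) (hF : ∀ i, F i i = 0) {i j : Fin n}
    (hij : i ≠ j) :
    (n * (n - 1) : ℝ) * ∑ π : Equiv.Perm (Fin n), F (π i) (π j) =
      n.factorial * ∑ a, ∑ b, F a b := by
  -- The inner sum does not depend on the pair of distinct indices, so it may be averaged over them.
  have hconst : ∀ a b : Fin n, ∑ π : Equiv.Perm (Fin n), F (π a) (π b) =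
      if a = b then 0 else ∑ π : Equiv.Perm (Fin n), F (π i) (π j) := by
    intro a b
    split_ifs with hab
    · simp [hab, hF]
    · obtain ⟨σ, hσ⟩ := (MulAction.is_two_pretransitive_iff (G := Equiv.Perm (Fin n))).1
        (Equiv.Perm.isMultiplyPretransitive (Fin n) 2) hij hab
      rw [← Equiv.sum_comp (Equiv.mulRight σ) fun π => F (π i) (π j)]
      simp only [Equiv.Perm.smul_def] at hσ
      simp [hσ.1, hσ.2]
  have h1 : ∑ a, ∑ b, ∑ π : Equiv.Perm (Fin n), F (π a) (π b) =
      n.factorial * ∑ a, ∑ b, F a b := by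
    have : ∀ π : Equiv.Perm (Fin n), ∑ a, ∑ b, F (π a) (π b) = ∑ a, ∑ b, F a b := by
      intro π
      rw [← Equiv.sum_comp π fun a => ∑ b, F a b]
      exact Finset.sum_congr rfl fun a _ => Equiv.sum_comp π fun b => F (π a) b
    calc ∑ a, ∑ b, ∑ π : Equiv.Perm (Fin n), F (π a) (π b)
        = ∑ π : Equiv.Perm (Fin n), ∑ a, ∑ b, F (π a) (π b) := by
          rw [Finset.sum_comm]
          simp_rw [fun b => Finset.sum_comm (s := (Finset.univ : Finset (Fin n)))
            (t := (Finset.univ : Finset (Equiv.Perm (Fin n)))) (f := fun a π => F (π a) (π b))]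
          rw [Finset.sum_comm]
          exact Finset.sum_congr rfl fun π _ => Finset.sum_comm
      _ = _ := by simp [this, Fintype.card_perm]
  rw [← h1]
  rw [Finset.sum_congr rfl fun a _ => Finset.sum_congr rfl fun b _ => hconst a b]
  simp only [Finset.sum_ite, Finset.sum_const_zero, zero_add, Finset.sum_const, nsmul_eq_mul]
  have hc : ∀ a : Fin n, (((Finset.univ.filter fun b => ¬ a = b).card : ℕ) : ℝ) = n - 1 := by
    intro a
    rw [Finset.filter_not, Finset.filter_eq, if_pos (Finset.mem_univ a),
      Finset.card_sdiff_of_subset (Finset.subset_univ _)]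
    have : 1 ≤ n := a.pos
    simp [Nat.cast_sub this]
  simp [hc]
  ring

theorem sampleVariance_eq_sum_sq_sub {n : ℕ} (hn : 2 ≤ n) (z : Fin n → ℝ) :
    sampleVariance z = (∑ i, ∑ j, (z i - z j) ^ 2 / 2) / (n * (n - 1)) := by
  have hn0 : (n : ℝ) ≠ 0 := by positivity
  have hn1 : (n : ℝ) - 1 ≠ 0 := by
    have : (2 : ℝ) ≤ n := by exact_mod_cast hn
    linarith
  have hs : ∑ i, z i = n * sampleMean z := by rw [sampleMean]; field_simp
  have h1 : ∑ i, (z i - sampleMean z) ^ 2 = ∑ i, z i ^ 2 - n * sampleMean z ^ 2 := by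
    simp_rw [sub_sq, Finset.sum_add_distrib, Finset.sum_sub_distrib, ← Finset.sum_mul,
      ← Finset.mul_sum, hs]
    simp
    ring
  have h2 : ∑ i, ∑ j, (z i - z j) ^ 2 / 2 = n * ∑ i, z i ^ 2 - (n * sampleMean z) ^ 2 := by
    simp_rw [← Finset.sum_div, sub_sq, Finset.sum_add_distrib, Finset.sum_sub_distrib,
      ← Finset.mul_sum, ← Finset.sum_mul, ← Finset.mul_sum, hs]
    simp
    rw [← Finset.mul_sum]
    ring
  rw [sampleVariance, h1, h2]
  field_simp

/-- The sample variance is the average, over all permutations of the sample, of averages of the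
kernel `(x - y)² / 2` over disjoint pairs of sample points. -/
theorem sampleVariance_eq_average {n m : ℕ} (hn : 2 ≤ n) (hm : 0 < m)
    (e : Fin m ⊕ Fin m → Fin n) (he : Function.Injective e) (z : Fin n → ℝ) :
    sampleVariance z = ∑ π : Equiv.Perm (Fin n), ((n.factorial : ℝ)⁻¹) *
      ((∑ l, (z (π (e (.inl l))) - z (π (e (.inr l)))) ^ 2 / 2) / (m : ℝ)) := by
  have hn0 : (n : ℝ) ≠ 0 := by positivity
  have hn1 : (n : ℝ) - 1 ≠ 0 := by
    have : (2 : ℝ) ≤ n := by exact_mod_cast hn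
    linarith
  have hf : (n.factorial : ℝ) ≠ 0 := by positivity
  have key : ∀ l, ∑ π : Equiv.Perm (Fin n), (z (π (e (.inl l))) - z (π (e (.inr l)))) ^ 2 / 2 =
      n.factorial * sampleVariance z := by
    intro l
    have h := card_mul_sum_perm (fun a b => (z a - z b) ^ 2 / 2) (by simp)
      (he.ne (Sum.inl_ne_inr (a := l) (b := l)))
    rw [sampleVariance_eq_sum_sq_sub hn, ← mul_div_assoc, ← h]
    field_simp
  rw [← Finset.mul_sum, ← Finset.sum_div, Finset.sum_comm]
  simp_rw [key]
  simp
  field_simp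

theorem sampleVariance_nonneg {n : ℕ} (hn : 2 ≤ n) (z : Fin n → ℝ) : 0 ≤ sampleVariance z := by
  have : (2 : ℝ) ≤ n := by exact_mod_cast hn
  exact div_nonneg (Finset.sum_nonneg fun i _ => sq_nonneg _) (by linarith)

/-! ### The lower tail of the sample variance -/

theorem measurePreserving_pairs {S : Type*} [MeasurableSpace S] (ν : Measure S)
    [IsProbabilityMeasure ν] {n m : ℕ} (e : Fin m ⊕ Fin m → Fin n) (he : Function.Injective e) :
    MeasurePreserving (fun (z : Fin n → S) (l : Fin m) => (z (e (.inl l)), z (e (.inr l))))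
      (Measure.pi fun _ => ν) (Measure.pi fun _ => ν.prod ν) := by
  have h1 : MeasurePreserving (fun (z : Fin n → S) (l : Fin m ⊕ Fin m) => z (e l))
      (Measure.pi fun _ => ν) (Measure.pi fun _ => ν) := by
    refine ⟨by fun_prop, ?_⟩
    have hind := (iIndepFun_pi (μ := fun _ : Fin n => ν) (X := fun _ x => x)
      (fun _ => aemeasurable_id)).precomp he
    rw [hind.map_fun_eq_pi_map (fun i => (measurable_pi_apply _).aemeasurable)]
    congr 1
    ext1 i
    exact (measurePreserving_eval (fun _ : Fin n => ν) (e i)).map_eq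
  have h2 := measurePreserving_sumPiEquivProdPi (fun _ : Fin m ⊕ Fin m => ν)
  have h3 := (measurePreserving_arrowProdEquivProdArrow S S (Fin m) (fun _ => ν) (fun _ => ν)).symm
  exact (h3.comp h2).comp h1

theorem ae_prod_sq_sub_le {ν : Measure ℝ} [SFinite ν] {B : ℝ} (h : ∀ᵐ x ∂ν, 0 ≤ x ∧ x ≤ B) :
    ∀ᵐ q ∂(ν.prod ν), (q.1 - q.2) ^ 2 ≤ B ^ 2 := by
  have h1 := (Measure.quasiMeasurePreserving_fst (μ := ν) (ν := ν)).ae h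
  have h2 := (Measure.quasiMeasurePreserving_snd (μ := ν) (ν := ν)).ae h
  filter_upwards [h1, h2] with q hq1 hq2
  exact sq_le_sq' (by linarith) (by linarith)

section RealSample

variable {ν : Measure ℝ} [IsProbabilityMeasure ν]

theorem integral_prod_sq_sub {B : ℝ} (h : ∀ᵐ x ∂ν, 0 ≤ x ∧ x ≤ B) :
    ∫ q, (q.1 - q.2) ^ 2 / 2 ∂(ν.prod ν) = ∫ x, (x - ∫ y, y ∂ν) ^ 2 ∂ν := by
  set p := ∫ y, y ∂ν with hp
  have hi : Integrable (fun x : ℝ => x) ν := by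
    refine integrable_of_ae_abs_le measurable_id (B := B) ?_
    filter_upwards [h] with x hx
    exact (abs_of_nonneg hx.1).trans_le hx.2
  have hi2 : Integrable (fun x : ℝ => (x - p) ^ 2) ν := by
    refine integrable_of_ae_abs_le (by fun_prop) (B := (B + |p|) ^ 2) ?_
    filter_upwards [h] with x hx
    rw [abs_pow]
    refine pow_le_pow_left₀ (abs_nonneg _) ((abs_sub x p).trans ?_) 2
    rw [abs_of_nonneg hx.1]
    linarith [hx.2]
  have hi1 : Integrable (fun x : ℝ => x - p) ν := hi.sub (integrable_const p)
  have h0 : ∫ x, (x - p) ∂ν = 0 := by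
    rw [integral_sub hi (integrable_const p)]
    simp [hp]
  have hprod : Integrable (fun q : ℝ × ℝ => (q.1 - p) * (q.2 - p)) (ν.prod ν) := hi1.mul_prod hi1
  have ha : Integrable (fun q : ℝ × ℝ => (q.1 - p) ^ 2 / 2) (ν.prod ν) :=
    (hi2.comp_fst ν).div_const 2
  have hb : Integrable (fun q : ℝ × ℝ => (q.2 - p) ^ 2 / 2) (ν.prod ν) :=
    (hi2.comp_snd ν).div_const 2
  have hab : Integrable (fun q : ℝ × ℝ => (q.1 - p) ^ 2 / 2 + (q.2 - p) ^ 2 / 2) (ν.prod ν) :=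
    ha.add hb
  calc ∫ q, (q.1 - q.2) ^ 2 / 2 ∂(ν.prod ν)
      = ∫ q, ((q.1 - p) ^ 2 / 2 + (q.2 - p) ^ 2 / 2 - (q.1 - p) * (q.2 - p)) ∂(ν.prod ν) := by
        refine integral_congr_ae (Eventually.of_forall fun q => ?_)
        simp only
        ring
    _ = _ := by
        rw [integral_sub hab hprod, integral_add ha hb,
          integral_prod_mul (fun x => x - p) (fun y => y - p), h0,
          integral_fun_fst (fun x : ℝ => (x - p) ^ 2 / 2),
          integral_fun_snd (fun x : ℝ => (x - p) ^ 2 / 2), integral_div]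
        simp

/-- Laplace transform bound for the sample variance. By Jensen's inequality it suffices to bound
the Laplace transform of an average over disjoint pairs, where the summands are independent. -/
theorem integral_exp_neg_sampleVariance_le {B lam : ℝ} (h : ∀ᵐ x ∂ν, 0 ≤ x ∧ x ≤ B)
    (hlam : 0 ≤ lam) {n m : ℕ} (hm : 0 < m) (hmn : 2 * m ≤ n) :
    ∫ z, Real.exp (-(lam * sampleVariance z)) ∂(Measure.pi fun _ : Fin n => ν) ≤
      Real.exp (-(lam * ∫ x, (x - ∫ y, y ∂ν) ^ 2 ∂ν) +
        lam ^ 2 * (B ^ 2 * ∫ x, (x - ∫ y, y ∂ν) ^ 2 ∂ν) / (4 * m)) := by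
  have hn : 2 ≤ n := by omega
  set v := ∫ x, (x - ∫ y, y ∂ν) ^ 2 ∂ν with hv
  obtain ⟨e⟩ : Nonempty (Fin m ⊕ Fin m ↪ Fin n) := by
    refine Function.Embedding.nonempty_of_card_le ?_
    simp
    omega
  let W : ℝ × ℝ → ℝ := fun q => (q.1 - q.2) ^ 2 / 2
  have hWm : Measurable W := by fun_prop
  have hW0 : ∀ q, 0 ≤ W q := fun q => by positivity
  have hae := ae_prod_sq_sub_le h
  have hWB : ∀ᵐ q ∂(ν.prod ν), |W q| ≤ B ^ 2 / 2 := by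
    filter_upwards [hae] with q hq
    rw [abs_of_nonneg (hW0 q)]
    simp only [W]
    linarith
  have hWv : ∫ q, W q ∂(ν.prod ν) = v := integral_prod_sq_sub h
  have hiW : Integrable W (ν.prod ν) := integrable_of_ae_abs_le hWm hWB
  have hW2 : ∫ q, W q ^ 2 ∂(ν.prod ν) ≤ B ^ 2 / 2 * v := by
    rw [← hWv, ← integral_const_mul]
    refine integral_mono_ae ?_ (hiW.const_mul _) ?_
    · refine integrable_of_ae_abs_le (hWm.pow_const 2) (B := (B ^ 2 / 2) ^ 2) ?_
      filter_upwards [hWB] with q hq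
      rw [abs_pow]
      exact pow_le_pow_left₀ (abs_nonneg _) hq 2
    · filter_upwards [hWB] with q hq
      rw [abs_of_nonneg (hW0 q)] at hq
      simp only [sq (W q)]
      exact mul_le_mul_of_nonneg_right hq (hW0 q)
  let G : Equiv.Perm (Fin n) → (Fin n → ℝ) → ℝ := fun π z =>
    Real.exp (-(lam * ((∑ l, (z (π (e (.inl l))) - z (π (e (.inr l)))) ^ 2 / 2) / m)))
  have hGi : ∀ π, Integrable (G π) (Measure.pi fun _ : Fin n => ν) := by
    intro π
    refine integrable_of_ae_abs_le (by fun_prop) (B := 1) (Eventually.of_forall fun z => ?_)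
    rw [Real.abs_exp, Real.exp_le_one_iff, neg_nonpos]
    positivity
  have hG : ∀ π, ∫ z, G π z ∂(Measure.pi fun _ : Fin n => ν) ≤
      Real.exp (-(lam * v) + lam ^ 2 * (B ^ 2 * v) / (4 * m)) := by
    intro π
    have hmp := measurePreserving_pairs ν (fun l => π (e l)) (π.injective.comp e.injective)
    have h1 : ∫ z, G π z ∂(Measure.pi fun _ : Fin n => ν) =
        ∫ w, ∏ l, Real.exp (-(lam / m * W (w l))) ∂(Measure.pi fun _ : Fin m => ν.prod ν) := by
      rw [← hmp.map_eq, integral_map hmp.measurable.aemeasurable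
        (Measurable.aestronglyMeasurable (by fun_prop))]
      refine integral_congr_ae (Eventually.of_forall fun z => ?_)
      simp only [G, W]
      rw [← Real.exp_sum]
      congr 1
      rw [Finset.sum_neg_distrib, ← Finset.mul_sum]
      ring
    rw [h1, integral_fintype_prod_eq_pow (fun q => Real.exp (-(lam / m * W q))), Fintype.card_fin]
    have h2 := integral_exp_neg_le hWm hWB hW0 (θ := lam / m) (by positivity)
    refine (pow_le_pow_left₀ (integral_nonneg fun x => (Real.exp_pos _).le) h2 m).trans ?_
    rw [← Real.exp_nat_mul, Real.exp_le_exp, hWv]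
    have h3 : (m : ℝ) * (-(lam / m * v) + (lam / m) ^ 2 * (∫ q, W q ^ 2 ∂(ν.prod ν)) / 2) =
        -(lam * v) + lam ^ 2 / (2 * m) * (∫ q, W q ^ 2 ∂(ν.prod ν)) := by
      field_simp
    rw [h3]
    have h4 := mul_le_mul_of_nonneg_left hW2 (show 0 ≤ lam ^ 2 / (2 * m) by positivity)
    refine (add_le_add_right h4 _).trans (le_of_eq ?_)
    field_simp
    ring
  have hfac : (n.factorial : ℝ) ≠ 0 := by positivity
  calc ∫ z, Real.exp (-(lam * sampleVariance z)) ∂(Measure.pi fun _ : Fin n => ν)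
      ≤ ∫ z, ∑ π : Equiv.Perm (Fin n), (n.factorial : ℝ)⁻¹ * G π z
          ∂(Measure.pi fun _ : Fin n => ν) := by
        refine integral_mono_of_nonneg (Eventually.of_forall fun z => (Real.exp_pos _).le)
          (integrable_finsetSum _ fun π _ => (hGi π).const_mul _)
          (Eventually.of_forall fun z => ?_)
        have hJ := convexOn_exp.map_sum_le (t := (Finset.univ : Finset (Equiv.Perm (Fin n))))
          (w := fun _ => (n.factorial : ℝ)⁻¹)
          (p := fun π => -(lam * ((∑ l, (z (π (e (.inl l))) - z (π (e (.inr l)))) ^ 2 / 2) / m)))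
          (fun _ _ => by positivity) (by simp [Fintype.card_perm, hfac])
          (fun _ _ => Set.mem_univ _)
        simp only [smul_eq_mul] at hJ
        refine le_trans (le_of_eq ?_) hJ
        simp only
        rw [sampleVariance_eq_average hn hm e e.injective z, Finset.mul_sum,
          ← Finset.sum_neg_distrib]
        congr 1
        refine Finset.sum_congr rfl fun π _ => ?_
        ring
    _ = ∑ π : Equiv.Perm (Fin n), (n.factorial : ℝ)⁻¹ *
          ∫ z, G π z ∂(Measure.pi fun _ : Fin n => ν) := by
        rw [integral_finsetSum _ fun π _ => (hGi π).const_mul _]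
        simp_rw [integral_const_mul]
    _ ≤ ∑ π : Equiv.Perm (Fin n), (n.factorial : ℝ)⁻¹ *
          Real.exp (-(lam * v) + lam ^ 2 * (B ^ 2 * v) / (4 * m)) :=
        Finset.sum_le_sum fun π _ => mul_le_mul_of_nonneg_left (hG π) (by positivity)
    _ = _ := by simp [Fintype.card_perm, hfac]

/-- The deviation is stated for `n - 1` because an odd sample has only `(n - 1) / 2` disjoint pairs. -/
theorem sampleVariance_lower_tail {B L : ℝ} (h : ∀ᵐ x ∂ν, 0 ≤ x ∧ x ≤ B) (hB : 0 < B) (hL : 0 ≤ L)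
    (hv : 0 < ∫ x, (x - ∫ y, y ∂ν) ^ 2 ∂ν) {n : ℕ} (hn : 2 ≤ n) :
    (Measure.pi fun _ : Fin n => ν).real
      {z | sampleVariance z ≤ (∫ x, (x - ∫ y, y ∂ν) ^ 2 ∂ν) -
        √(∫ x, (x - ∫ y, y ∂ν) ^ 2 ∂ν) * (B * √(2 * L / (n - 1)))} ≤ Real.exp (-L) := by
  set v := ∫ x, (x - ∫ y, y ∂ν) ^ 2 ∂ν with hv_def
  set t := √v * (B * √(2 * L / (n - 1))) with ht
  have hm : 0 < n / 2 := by omega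
  set m := n / 2 with hm_def
  have hm' : (0 : ℝ) < m := by exact_mod_cast hm
  have hn' : (2 : ℝ) ≤ n := by exact_mod_cast hn
  have hnm : ((n : ℝ) - 1) ≤ 2 * m := by
    have : n ≤ 2 * m + 1 := by omega
    have : (n : ℝ) ≤ 2 * m + 1 := by exact_mod_cast this
    linarith
  have hn1 : (0 : ℝ) < n - 1 := by linarith
  have ht0 : 0 ≤ t := by positivity
  have ht2 : t ^ 2 = v * B ^ 2 * (2 * L / (n - 1)) := by
    rw [ht, mul_pow, mul_pow, Real.sq_sqrt hv.le, Real.sq_sqrt (by positivity)]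
    ring
  -- This `lam` minimizes the exponent `-lam * t + lam² B² v / (4 m)`.
  set lam := 2 * m * t / (B ^ 2 * v) with hlam
  have hlam0 : 0 ≤ lam := by positivity
  have hmeas : Measurable fun z : Fin n → ℝ => sampleVariance z := by
    unfold sampleVariance sampleMean
    fun_prop
  have hie : Integrable (fun z : Fin n → ℝ => Real.exp (-lam * sampleVariance z))
      (Measure.pi fun _ : Fin n => ν) := by
    refine integrable_of_ae_abs_le (by fun_prop) (B := 1) (Eventually.of_forall fun z => ?_)
    rw [Real.abs_exp, Real.exp_le_one_iff]
    have := mul_nonneg hlam0 (sampleVariance_nonneg hn z)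
    linarith
  refine (measure_le_le_exp_mul_mgf _ (neg_nonpos.mpr hlam0) hie).trans ?_
  have hM := integral_exp_neg_sampleVariance_le h hlam0 hm (show 2 * m ≤ n by omega)
  rw [mgf]
  simp_rw [neg_mul]
  refine (mul_le_mul_of_nonneg_left hM (Real.exp_pos _).le).trans ?_
  rw [← Real.exp_add, Real.exp_le_exp, ← hv_def]
  have e1 : lam * t = 2 * m * t ^ 2 / (B ^ 2 * v) := by rw [hlam]; ring
  have e2 : lam ^ 2 * (B ^ 2 * v) / (4 * m) = m * t ^ 2 / (B ^ 2 * v) := by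
    rw [hlam]; field_simp; ring
  have e3 : m * t ^ 2 / (B ^ 2 * v) = 2 * m / (n - 1) * L := by
    rw [ht2]; field_simp
  have e4 : L ≤ 2 * m / (n - 1) * L := by
    refine le_mul_of_one_le_left hL ?_
    rw [one_le_div hn1]
    exact hnm
  have e5 : 2 * m * t ^ 2 / (B ^ 2 * v) = 2 * (m * t ^ 2 / (B ^ 2 * v)) := by ring
  rw [e2]
  linarith

/-! ### The empirical Bernstein inequality -/

/-- Replacing the variance `v` in Bernstein's bound by the sample variance `V`: the lower tail bound
gives `√v ≤ √V + B √(2 L / (n - 1))`, by completing the square. -/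
theorem le_empirical_bound {D v V B L : ℝ} {n : ℕ} (hn : 2 ≤ n) (hv : 0 ≤ v) (hV : 0 ≤ V)
    (hB : 0 ≤ B) (hL : 0 ≤ L) (hD : D ≤ (√(2 * (n * v) * L) + B / 3 * L) / n)
    (hvV : v - √v * (B * √(2 * L / (n - 1))) ≤ V) :
    D ≤ √(2 * V * L / n) + 7 * L * B / (3 * (n - 1)) := by
  have hn' : (2 : ℝ) ≤ n := by exact_mod_cast hn
  have hn1 : (0 : ℝ) < n - 1 := by linarith
  have hn0 : (0 : ℝ) < n := by linarith
  set c := B * √(2 * L / (n - 1)) with hc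
  have hc0 : 0 ≤ c := by positivity
  have hs : √v ≤ √V + c := by
    have h1 : (√v - c / 2) ^ 2 ≤ (√V + c / 2) ^ 2 := by
      have := Real.sq_sqrt hv
      have := Real.sq_sqrt hV
      have := mul_nonneg (Real.sqrt_nonneg V) hc0
      nlinarith
    have := abs_le_of_sq_le_sq h1 (by positivity)
    linarith [le_of_abs_le this]
  set u := √(2 * L / n) with hu
  have hu0 : 0 ≤ u := Real.sqrt_nonneg _
  have h1 : √(2 * (n * v) * L) / n = √v * u := by
    rw [hu, ← Real.sqrt_mul hv, div_eq_iff hn0.ne',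
      Real.sqrt_eq_iff_mul_self_eq (by positivity) (by positivity)]
    have := Real.mul_self_sqrt (show 0 ≤ v * (2 * L / n) by positivity)
    calc 2 * (n * v) * L = (v * (2 * L / n)) * (n * n) := by field_simp
      _ = √(v * (2 * L / n)) * √(v * (2 * L / n)) * (n * n) := by rw [this]
      _ = _ := by ring
  have h2 : √(2 * V * L / n) = √V * u := by
    rw [hu, ← Real.sqrt_mul hV]
    congr 1
    ring
  have h3 : c * u ≤ B * (2 * L / (n - 1)) := by
    have hle : u ≤ √(2 * L / (n - 1)) :=
      Real.sqrt_le_sqrt (div_le_div_of_nonneg_left (by positivity) hn1 (by linarith))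
    calc c * u ≤ c * √(2 * L / (n - 1)) := mul_le_mul_of_nonneg_left hle hc0
      _ = B * (2 * L / (n - 1)) := by
        rw [hc, mul_assoc, Real.mul_self_sqrt (by positivity)]
  have h4 : B / 3 * L / n ≤ B / 3 * L / (n - 1) :=
    div_le_div_of_nonneg_left (by positivity) hn1 (by linarith)
  have h5 := mul_le_mul_of_nonneg_right hs hu0
  have h6 : B * (2 * L / (n - 1)) + B / 3 * L / (n - 1) = 7 * L * B / (3 * (n - 1)) := by
    field_simp
    ring
  rw [add_div, h1] at hD
  rw [h2, ← h6]
  linarith [add_mul (√V) c u]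

/-- The **empirical Bernstein inequality**, two-sided. -/
theorem empirical_bernstein_pi {B L : ℝ} (h : ∀ᵐ x ∂ν, 0 ≤ x ∧ x ≤ B) (hB : 0 < B) (hL : 0 ≤ L)
    {n : ℕ} (hn : 2 ≤ n) :
    (Measure.pi fun _ : Fin n => ν).real
      {z | √(2 * sampleVariance z * L / n) + 7 * L * B / (3 * (n - 1)) <
        |sampleMean z - ∫ y, y ∂ν|} ≤ 3 * Real.exp (-L) := by
  set p := ∫ y, y ∂ν with hp
  set v := ∫ x, (x - p) ^ 2 ∂ν with hv
  set P := Measure.pi fun _ : Fin n => ν with hP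
  have hn' : (2 : ℝ) ≤ n := by exact_mod_cast hn
  have hn1 : (0 : ℝ) < n - 1 := by linarith
  have hn0 : (0 : ℝ) < n := by linarith
  have hi : Integrable (fun x : ℝ => x) ν := by
    refine integrable_of_ae_abs_le measurable_id (B := B) ?_
    filter_upwards [h] with x hx
    exact (abs_of_nonneg hx.1).trans_le hx.2
  have hp0 : 0 ≤ p := integral_nonneg_of_ae (h.mono fun x hx => hx.1)
  have hpB : p ≤ B := by
    have := integral_mono_ae hi (integrable_const B) (h.mono fun x hx => hx.2)
    simpa using this
  have hφ : ∀ᵐ x ∂ν, |x - p| ≤ B := h.mono fun x hx => abs_le.2 ⟨by linarith, by linarith⟩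
  have hi2 : Integrable (fun x : ℝ => (x - p) ^ 2) ν := by
    refine integrable_of_ae_abs_le (by fun_prop) (B := B ^ 2) ?_
    filter_upwards [hφ] with x hx
    rw [abs_pow]
    exact pow_le_pow_left₀ (abs_nonneg _) hx 2
  have h0 : ∫ x, (x - p) ∂ν = 0 := by
    rw [integral_sub hi (integrable_const p)]
    simp [hp]
  have hv0 : 0 ≤ v := integral_nonneg fun x => sq_nonneg _
  have hdev : ∀ z : Fin n → ℝ, sampleMean z - p = (∑ i, (z i - p)) / n := by
    intro z
    rw [sampleMean, Finset.sum_sub_distrib]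
    simp
    field_simp
  rcases hv0.eq_or_lt with hv0 | hvpos
  · -- A law with zero variance is a point mass, and the sample mean is exact.
    have hx : ∀ᵐ x ∂ν, x = p := by
      have := (integral_eq_zero_iff_of_nonneg (fun x => sq_nonneg (x - p)) hi2).1 hv0.symm
      filter_upwards [this] with x hx
      have : (x - p) ^ 2 = 0 := hx
      have := pow_eq_zero_iff (two_ne_zero) |>.1 this
      linarith
    have hz : ∀ᵐ z ∂P, ∀ i, z i = p := by
      rw [ae_all_iff]
      intro i
      exact (Measure.quasiMeasurePreserving_eval (fun _ : Fin n => ν) i).ae hx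
    have hnull : P {z | √(2 * sampleVariance z * L / n) + 7 * L * B / (3 * (n - 1)) <
        |sampleMean z - p|} = 0 := by
      refine measure_mono_null (fun z hz' => ?_) (ae_iff.1 hz)
      intro hall
      have hz'' : √(2 * sampleVariance z * L / n) + 7 * L * B / (3 * (n - 1)) <
        |sampleMean z - p| := hz'
      rw [hdev] at hz''
      simp only [hall, sub_self, Finset.sum_const_zero, zero_div, abs_zero] at hz''
      have : 0 ≤ √(2 * sampleVariance z * L / n) + 7 * L * B / (3 * (n - 1)) := by positivity
      linarith
    rw [measureReal_def, hnull]
    simp only [ENNReal.toReal_zero]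
    positivity
  · set b := √(2 * (n * v) * L) + B / 3 * L with hb
    have hA := bernstein_pi (ν := ν) (φ := fun x => x - p) (by fun_prop) hB.le hL hφ h0 hvpos
      (n := n) (by omega)
    have hA' := bernstein_pi (ν := ν) (φ := fun x => -(x - p)) (by fun_prop) hB.le hL
      (by simpa only [abs_neg] using hφ) (by rw [integral_neg, h0, neg_zero])
      (by simpa only [neg_sq] using hvpos) (n := n) (by omega)
    simp only [neg_sq] at hA'
    have hC := sampleVariance_lower_tail h hB hL hvpos hn
    rw [← hv, ← hP] at hA hA' hC
    refine le_trans (measureReal_mono (s₂ := ({z | b ≤ ∑ i, (z i - p)} ∪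
      {z | b ≤ ∑ i, -(z i - p)}) ∪ {z | sampleVariance z ≤ v - √v * (B * √(2 * L / (n - 1)))})
      (fun z hz => ?_) (measure_ne_top _ _)) ?_
    · by_contra hcon
      simp only [Set.mem_union, Set.mem_ofPred_eq, not_or, not_le, Finset.sum_neg_distrib] at hcon
      have hz' : √(2 * sampleVariance z * L / n) + 7 * L * B / (3 * (n - 1)) <
        |sampleMean z - p| := hz
      refine absurd (le_empirical_bound hn hv0 (sampleVariance_nonneg hn z) hB.le hL ?_ hcon.2.le)
        hz'.not_ge
      rw [hdev, abs_div, abs_of_pos hn0]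
      refine div_le_div_of_nonneg_right (abs_le.2 ⟨?_, hcon.1.1.le⟩) hn0.le
      linarith [hcon.1.2]
    · refine (measureReal_union_le _ _).trans ?_
      have := measureReal_union_le (μ := P) {z | b ≤ ∑ i, (z i - p)} {z | b ≤ ∑ i, -(z i - p)}
      linarith

end RealSample

/-! ### Existence of the tilting points -/

section Duality

variable {d : ℕ} {f : Space d → ℝ}

/-- A convex function lies above its tangent at a point of differentiability. -/
theorem add_fderiv_apply_sub_le {E : Type*} [NormedAddCommGroup E] [NormedSpace ℝ E] {D : Set E}
    {φ : E → ℝ} (hφ : ConvexOn ℝ D φ) {s x : E} (hs : s ∈ D) (hx : x ∈ D) {φ' : E →L[ℝ] ℝ}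
    (h : HasFDerivAt φ φ' s) : φ s + φ' (x - s) ≤ φ x := by
  have hl := (h.hasLineDerivAt (x - s)).tendsto_slope_zero_right
  have hev : ∀ᶠ t : ℝ in 𝓝[>] 0,
      t⁻¹ • (φ (s + t • (x - s)) - φ s) ≤ φ x - φ s := by
    filter_upwards [Ioo_mem_nhdsGT (zero_lt_one (α := ℝ))] with t ht
    have hc := hφ.2 hs hx (sub_nonneg.2 ht.2.le) ht.1.le (sub_add_cancel 1 t)
    have he : (1 - t) • s + t • x = s + t • (x - s) := by module
    rw [he] at hc
    simp only [smul_eq_mul] at hc ⊢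
    rw [inv_mul_le_iff₀ ht.1]
    linarith
  have := le_of_tendsto hl (by simpa using hev)
  linarith

theorem cumulant_zero (hf : IsDensity f) : cumulant f 0 = 0 := by
  have := hf.isProbabilityMeasure
  simp [cumulant]

theorem rate_nonneg (hf : IsDensity f) (y : Space d) : 0 ≤ rate f y := by
  refine le_trans (le_of_eq ?_) (le_iSup _ (0 : Space d))
  simp [cumulant_zero hf]

theorem inner_sub_cumulant_le_rate (x y : Space d) :
    ((inner ℝ x y : ℝ) : EReal) - cumulant f x ≤ rate f y :=
  le_iSup (fun x : Space d => ((inner ℝ x y : ℝ) : EReal) - cumulant f x) x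

namespace RegularCumulant

theorem coe_cumulantReal (hμ : RegularCumulant f) {x : Space d} (hx : x ∈ cumulantDom f) :
    ((cumulantReal f x : ℝ) : EReal) = cumulant f x :=
  EReal.coe_toReal (ne_of_lt hx) (hμ.proper.1 x)

theorem convexOn (hμ : RegularCumulant f) : ConvexOn ℝ (cumulantDom f) (cumulantReal f) := by
  have key : ∀ x ∈ cumulantDom f, ∀ y ∈ cumulantDom f, ∀ a b : ℝ, 0 ≤ a → 0 ≤ b → a + b = 1 →
      cumulant f (a • x + b • y) ≤ ((a * cumulantReal f x + b * cumulantReal f y : ℝ) : EReal) := by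
    intro x hx y hy a b ha hb hab
    exact hμ.convex (x := (x, cumulantReal f x)) (y := (y, cumulantReal f y))
      (hμ.coe_cumulantReal hx).ge (hμ.coe_cumulantReal hy).ge ha hb hab
  have hconv : Convex ℝ (cumulantDom f) := fun x hx y hy a b ha hb hab =>
    (key x hx y hy a b ha hb hab).trans_lt (EReal.coe_lt_top _)
  refine ⟨hconv, fun x hx y hy a b ha hb hab => ?_⟩
  have h := key x hx y hy a b ha hb hab
  rw [← hμ.coe_cumulantReal (hconv hx hy ha hb hab), EReal.coe_le_coe_iff] at h
  exact h

theorem inner_sub_le (hμ : RegularCumulant f) {x y : Space d} (hx : x ∈ cumulantDom f) {M : ℝ}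
    (hM : rate f y ≤ M) : inner ℝ x y - cumulantReal f x ≤ M := by
  have h := (inner_sub_cumulant_le_rate x y).trans hM
  rw [← hμ.coe_cumulantReal hx, ← EReal.coe_sub, EReal.coe_le_coe_iff] at h
  exact h

theorem hasFDerivAt (hμ : RegularCumulant f) {s : Space d} (hs : s ∈ interior (cumulantDom f)) :
    HasFDerivAt (cumulantReal f) (innerSL ℝ (gradient (cumulantReal f) s)) s :=
  ((hμ.differentiable s hs).differentiableAt
    (isOpen_interior.mem_nhds hs)).hasGradientAt.hasFDerivAt

/-- Finiteness of the rate function near `y` makes `μ - ⟪·, y⟫` coercive, so its minimum is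
attained. -/
theorem exists_minimizer (hf : IsDensity f) (hμ : RegularCumulant f) {y : Space d}
    (hy : y ∈ interior (rateDom f)) :
    ∃ s ∈ cumulantDom f, ∀ x ∈ cumulantDom f,
      cumulantReal f s - inner ℝ s y ≤ cumulantReal f x - inner ℝ x y := by
  obtain ⟨δ, hδ, hball⟩ := Metric.isOpen_iff.1 isOpen_interior y hy
  set b := EuclideanSpace.basisFun (Fin d) ℝ with hb
  have hmem : ∀ (j : Fin d) (c : ℝ), |c| = δ / 2 → rate f (y + c • b j) < ⊤ := by
    intro j c hc
    have hsub : Metric.ball y δ ⊆ rateDom f := hball.trans interior_subset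
    refine hsub (?_ : y + c • b j ∈ Metric.ball y δ)
    rw [Metric.mem_ball, dist_eq_norm, add_sub_cancel_left, norm_smul, b.norm_eq_one,
      Real.norm_eq_abs, hc]
    linarith
  have hbd : ∀ (j : Fin d), ∃ M : ℝ, rate f (y + (δ / 2) • b j) ≤ M ∧
      rate f (y + (-(δ / 2)) • b j) ≤ M := by
    intro j
    have h1 := hmem j (δ / 2) (abs_of_pos (by linarith))
    have h2 := hmem j (-(δ / 2)) (by rw [abs_neg, abs_of_pos (by linarith)])
    refine ⟨max (rate f (y + (δ / 2) • b j)).toReal (rate f (y + (-(δ / 2)) • b j)).toReal, ?_, ?_⟩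
    · refine (EReal.le_coe_toReal h1.ne).trans (EReal.coe_le_coe_iff.2 (le_max_left _ _))
    · refine (EReal.le_coe_toReal h2.ne).trans (EReal.coe_le_coe_iff.2 (le_max_right _ _))
  choose M₀ hM₀ using hbd
  obtain ⟨M, hM⟩ := Finite.exists_le M₀
  have hcoord : ∀ x ∈ cumulantDom f, cumulantReal f x - inner ℝ x y ≤ 0 →
      ‖x‖ ≤ d * (M / (δ / 2)) := by
    intro x hx hx0
    have hj : ∀ j, |inner ℝ (b j) x| ≤ M / (δ / 2) := by
      intro j
      have h1 := (hμ.inner_sub_le hx (hM₀ j).1).trans (hM j)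
      have h2 := (hμ.inner_sub_le hx (hM₀ j).2).trans (hM j)
      rw [inner_add_right, inner_smul_right] at h1 h2
      rw [real_inner_comm x (b j), le_div_iff₀ (by linarith),
        ← abs_of_pos (show 0 < δ / 2 by linarith), ← abs_mul, abs_le]
      constructor <;> nlinarith
    calc ‖x‖ = ‖∑ j, inner ℝ (b j) x • b j‖ := by rw [b.sum_repr']
      _ ≤ ∑ j, ‖inner ℝ (b j) x • b j‖ := norm_sum_le _ _
      _ ≤ ∑ _j : Fin d, M / (δ / 2) := by
          refine Finset.sum_le_sum fun j _ => ?_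
          rw [norm_smul, b.norm_eq_one, mul_one]
          exact hj j
      _ = d * (M / (δ / 2)) := by simp
  let H : Space d → EReal := fun x => cumulant f x + ((-inner ℝ x y : ℝ) : EReal)
  have hH : LowerSemicontinuous H := by
    refine hμ.closed.add' ?_ fun x => ?_
    · exact (continuous_coe_real_ereal.comp (by fun_prop)).lowerSemicontinuous
    · exact EReal.continuousAt_add (Or.inr (EReal.coe_ne_bot _)) (Or.inr (EReal.coe_ne_top _))
  have hH0 : H 0 = 0 := by simp [H, cumulant_zero hf]
  have hHr : ∀ x ∈ cumulantDom f, H x = ((cumulantReal f x - inner ℝ x y : ℝ) : EReal) := by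
    intro x hx
    simp only [H]
    rw [← hμ.coe_cumulantReal hx, ← EReal.coe_add, sub_eq_add_neg]
  have h0dom : (0 : Space d) ∈ cumulantDom f := interior_subset hμ.zero_mem
  set R := max 0 (d * (M / (δ / 2))) with hR
  obtain ⟨s, hsK, hs⟩ := (hH.lowerSemicontinuousOn (Metric.closedBall 0 R)).exists_isMinOn
    ⟨0, by simp [hR]⟩ (isCompact_closedBall 0 R)
  have hs0 : H s ≤ 0 := hH0 ▸ hs (show (0 : Space d) ∈ Metric.closedBall 0 R by simp [hR])
  have hsdom : s ∈ cumulantDom f := by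
    by_contra hcon
    have htop : cumulant f s = ⊤ := not_lt_top_iff.1 hcon
    simp only [H, htop, EReal.top_add_coe] at hs0
    exact absurd hs0 (by simp)
  refine ⟨s, hsdom, fun x hx => ?_⟩
  have hs0' : cumulantReal f s - inner ℝ s y ≤ 0 := by
    rw [hHr s hsdom] at hs0
    exact_mod_cast hs0
  by_cases hxK : x ∈ Metric.closedBall 0 R
  · have h := hs hxK
    simp only [Set.mem_ofPred_eq] at h
    rw [hHr s hsdom, hHr x hx, EReal.coe_le_coe_iff] at h
    exact h
  · by_contra hcon
    refine hxK ?_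
    rw [mem_closedBall_zero_iff]
    exact (hcoord x hx (by linarith)).trans (le_max_right _ _)

/-- A minimizer of `μ - ⟪·, y⟫` is an interior point of the domain. Otherwise the gradients along
the segment from `0` to the minimizer would be bounded: each point `(1 - τ) s` of the segment is the
centre of a ball of radius proportional to `τ`, on which the convex function exceeds its minimum
only by a multiple of `τ`. -/
theorem minimizer_mem_interior (hμ : RegularCumulant f) {s y : Space d} (hs : s ∈ cumulantDom f)
    (hmin : ∀ x ∈ cumulantDom f,
      cumulantReal f s - inner ℝ s y ≤ cumulantReal f x - inner ℝ x y) :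
    s ∈ interior (cumulantDom f) := by
  by_contra hsi
  have hfr : s ∈ frontier (cumulantDom f) := ⟨subset_closure hs, hsi⟩
  set h : Space d → ℝ := fun x => cumulantReal f x - inner ℝ x y with hh
  have hconv : ConvexOn ℝ (cumulantDom f) h := by
    refine hμ.convexOn.sub ⟨hμ.convexOn.1, fun x _ z _ a b _ _ _ => ?_⟩
    simp only [inner_add_left, real_inner_smul_left, smul_eq_mul]
    exact le_refl _
  have hder : ∀ x ∈ interior (cumulantDom f),
      HasFDerivAt h (innerSL ℝ (gradient (cumulantReal f) x - y)) x := by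
    intro x hx
    have h2 : HasFDerivAt (fun x : Space d => inner ℝ x y) (innerSL ℝ y) x := by
      have := (innerSL ℝ y).hasFDerivAt (x := x)
      refine this.congr_of_eventuallyEq (Eventually.of_forall fun z => ?_)
      simp [real_inner_comm]
    have := (hμ.hasFDerivAt hx).sub h2
    rw [map_sub]
    exact this
  have hcont : ContinuousAt h 0 := (hder 0 hμ.zero_mem).continuousAt
  obtain ⟨ε, hε, hball⟩ := Metric.mem_nhds_iff.1
    (inter_mem (isOpen_interior.mem_nhds hμ.zero_mem)
      (hcont.eventually (gt_mem_nhds (lt_add_one (h 0)))))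
  set C := h 0 + 1 - h s with hC
  have hbound : ∀ τ : ℝ, 0 < τ → τ ≤ 1 → (1 - τ) • s ∈ interior (cumulantDom f) ∧
      ‖gradient (cumulantReal f) ((1 - τ) • s)‖ ≤ ‖y‖ + C / (ε / 2) := by
    intro τ hτ hτ1
    have hmem : (1 - τ) • s ∈ interior (cumulantDom f) := by
      have := hμ.convexOn.1.combo_interior_closure_mem_interior hμ.zero_mem (subset_closure hs) hτ
        (sub_nonneg.2 hτ1) (add_sub_cancel τ 1)
      simpa using this
    refine ⟨hmem, ?_⟩
    set q := gradient (cumulantReal f) ((1 - τ) • s) - y with hq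
    have hdir : ∀ u ∈ Metric.ball (0 : Space d) ε, inner ℝ q u ≤ C := by
      intro u hu
      have hu' := hball hu
      have hudom : u ∈ cumulantDom f := interior_subset hu'.1
      have h1 := hconv.2 hs hudom (sub_nonneg.2 hτ1) hτ.le (sub_add_cancel 1 τ)
      have h2 := add_fderiv_apply_sub_le hconv (interior_subset hmem)
        (hconv.1 hs hudom (sub_nonneg.2 hτ1) hτ.le (sub_add_cancel 1 τ)) (hder _ hmem)
      have h3 := hmin _ (interior_subset hmem)
      rw [add_sub_cancel_left, innerSL_apply_apply, inner_smul_right] at h2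
      simp only [smul_eq_mul] at h1
      have h4 : h u < h 0 + 1 := hu'.2
      have h5 : h s ≤ h ((1 - τ) • s) := h3
      have h6 : τ * inner ℝ q u ≤ τ * C := by
        have := mul_le_mul_of_nonneg_left h4.le hτ.le
        rw [hC, mul_sub]
        nlinarith
      exact le_of_mul_le_mul_left h6 hτ
    have hqn : ‖q‖ ≤ C / (ε / 2) := by
      rw [le_div_iff₀ (by linarith)]
      rcases eq_or_ne q 0 with hq0 | hq0
      · have := hdir 0 (by simpa using hε)
        simpa [hq0] using this
      · have hqpos : 0 < ‖q‖ := norm_pos_iff.2 hq0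
        have := hdir ((ε / 2 / ‖q‖) • q) (by
          rw [mem_ball_zero_iff, norm_smul, Real.norm_eq_abs, abs_of_pos (by positivity),
            div_mul_cancel₀ _ hqpos.ne']
          linarith)
        rw [inner_smul_right, real_inner_self_eq_norm_sq] at this
        refine le_trans (le_of_eq ?_) this
        field_simp
    have : gradient (cumulantReal f) ((1 - τ) • s) = y + q := by rw [hq]; abel
    rw [this]
    exact (norm_add_le _ _).trans (by linarith)
  have hτ : ∀ m : ℕ, 0 < 1 / ((m : ℝ) + 1) ∧ 1 / ((m : ℝ) + 1) ≤ 1 := fun m => by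
    refine ⟨by positivity, ?_⟩
    rw [div_le_one (by positivity)]
    linarith [Nat.cast_nonneg (α := ℝ) m]
  have hlim : Tendsto (fun m : ℕ => (1 - 1 / ((m : ℝ) + 1)) • s) atTop (𝓝 s) := by
    have := (tendsto_one_div_add_atTop_nhds_zero_nat (𝕜 := ℝ)).const_sub 1
    simpa using this.smul_const s
  have hsteep := hμ.steep _ s (fun m => (hbound _ (hτ m).1 (hτ m).2).1) hfr hlim
  obtain ⟨m, hm⟩ := (hsteep.eventually_gt_atTop (‖y‖ + C / (ε / 2))).exists
  exact absurd (hbound _ (hτ m).1 (hτ m).2).2 (not_le.2 hm)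

theorem exists_gradient_eq (hf : IsDensity f) (hμ : RegularCumulant f) {y : Space d}
    (hy : y ∈ interior (rateDom f)) :
    ∃ s ∈ interior (cumulantDom f), gradient (cumulantReal f) s = y := by
  obtain ⟨s, hs, hmin⟩ := exists_minimizer hf hμ hy
  have hsi := minimizer_mem_interior hμ hs hmin
  refine ⟨s, hsi, ?_⟩
  have h2 : HasFDerivAt (fun x : Space d => inner ℝ x y) (innerSL ℝ y) s := by
    have := (innerSL ℝ y).hasFDerivAt (x := s)
    refine this.congr_of_eventuallyEq (Eventually.of_forall fun z => ?_)
    simp [real_inner_comm]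
  have hloc : IsLocalMin (fun x => cumulantReal f x - inner ℝ x y) s := by
    filter_upwards [isOpen_interior.mem_nhds hsi] with x hx
    exact hmin x (interior_subset hx)
  have h0 := hloc.hasFDerivAt_eq_zero ((hμ.hasFDerivAt hsi).sub h2)
  rw [← map_sub] at h0
  have h1 := DFunLike.congr_fun h0 (gradient (cumulantReal f) s - y)
  rw [innerSL_apply_apply, zero_apply, inner_self_eq_zero] at h1
  exact sub_eq_zero.1 h1

theorem tilt_mem (hf : IsDensity f) (hμ : RegularCumulant f) {y : Space d}
    (hy : y ∈ interior (rateDom f)) : tilt f y ∈ interior (cumulantDom f) :=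
  Function.invFunOn_mem (exists_gradient_eq hf hμ hy)

theorem gradient_tilt (hf : IsDensity f) (hμ : RegularCumulant f) {y : Space d}
    (hy : y ∈ interior (rateDom f)) : gradient (cumulantReal f) (tilt f y) = y :=
  Function.invFunOn_eq (exists_gradient_eq hf hμ hy)

/-- The supremum defining the rate function is attained at the tilting point. -/
theorem rate_eq (hf : IsDensity f) (hμ : RegularCumulant f) {y : Space d}
    (hy : y ∈ interior (rateDom f)) :
    rate f y = ((inner ℝ (tilt f y) y - cumulantReal f (tilt f y) : ℝ) : EReal) := by
  have hs := tilt_mem hf hμ hy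
  refine le_antisymm (iSup_le fun x => ?_) ?_
  · by_cases hx : x ∈ cumulantDom f
    · rw [← hμ.coe_cumulantReal hx, ← EReal.coe_sub, EReal.coe_le_coe_iff]
      have h := add_fderiv_apply_sub_le hμ.convexOn (interior_subset hs) hx (hμ.hasFDerivAt hs)
      rw [gradient_tilt hf hμ hy, innerSL_apply_apply, inner_sub_right, real_inner_comm,
        real_inner_comm (tilt f y)] at h
      linarith
    · have htop : cumulant f x = ⊤ := not_lt_top_iff.1 hx
      simp [htop]
  · refine le_trans (le_of_eq ?_) (inner_sub_cumulant_le_rate (tilt f y) y)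
    rw [← hμ.coe_cumulantReal (interior_subset hs), EReal.coe_sub]

end RegularCumulant

end Duality

/-! ### The importance sampling law and its likelihood ratio -/

section FixedLevel

variable {d : ℕ} {f g : Space d → ℝ} {k : ℝ → ℕ} {a : ℝ → ℕ → Space d} {γ : ℝ}

/-- The density of the importance sampling law with respect to the law of `X`, a mixture of
exponential tilts. -/
noncomputable def tiltWeight (f : Space d → ℝ) (k : ℝ → ℕ) (a : ℝ → ℕ → Space d) (γ : ℝ)
    (x : Space d) : ℝ :=
  ∑ i ∈ Finset.Icc 1 (k γ), 1 / (k γ : ℝ) *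
    Real.exp (inner ℝ (tilt f (a γ i)) x - cumulantReal f (tilt f (a γ i)))

theorem tiltedDensity_eq (x : Space d) :
    tiltedDensity f k a γ x = f x * tiltWeight f k a γ x := rfl

theorem measurable_tiltWeight : Measurable (tiltWeight f k a γ) := by
  unfold tiltWeight
  fun_prop

theorem tiltWeight_pos (hk : 1 ≤ k γ) (x : Space d) : 0 < tiltWeight f k a γ x := by
  have : (0 : ℝ) < k γ := by exact_mod_cast hk
  exact Finset.sum_pos (fun i _ => by positivity) ⟨1, Finset.mem_Icc.2 ⟨le_rfl, hk⟩⟩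

theorem tiltedLaw_eq (hf : IsDensity f) :
    tiltedLaw f k a γ =
      (densityLaw f).withDensity fun x => ENNReal.ofReal (tiltWeight f k a γ x) := by
  rw [tiltedLaw, densityLaw, densityLaw,
    ← withDensity_mul _ hf.measurable.ennreal_ofReal measurable_tiltWeight.ennreal_ofReal]
  congr 1
  funext x
  rw [tiltedDensity_eq, ENNReal.ofReal_mul (hf.nonneg x)]
  rfl

theorem lintegral_exp_inner (hμ : RegularCumulant f) {s : Space d} (hs : s ∈ cumulantDom f) :
    ∫⁻ x, ENNReal.ofReal (Real.exp (inner ℝ s x)) ∂(densityLaw f) =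
      ENNReal.ofReal (Real.exp (cumulantReal f s)) := by
  rw [← EReal.exp_coe, hμ.coe_cumulantReal hs, cumulant, ENNReal.exp_log]

theorem isProbabilityMeasure_tiltedLaw (hf : IsDensity f) (hμ : RegularCumulant f)
    (hk : 1 ≤ k γ) (ha : ∀ i ∈ Finset.Icc 1 (k γ), a γ i ∈ interior (rateDom f)) :
    IsProbabilityMeasure (tiltedLaw f k a γ) := by
  refine ⟨?_⟩
  have hk0 : (0 : ℝ) < k γ := by exact_mod_cast hk
  have hterm : ∀ i ∈ Finset.Icc 1 (k γ), ∫⁻ x, ENNReal.ofReal (1 / (k γ : ℝ) *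
      Real.exp (inner ℝ (tilt f (a γ i)) x - cumulantReal f (tilt f (a γ i)))) ∂(densityLaw f) =
      ENNReal.ofReal (1 / (k γ : ℝ)) := by
    intro i hi
    have hs := interior_subset (hμ.tilt_mem hf (ha i hi))
    set s := tilt f (a γ i)
    have h1 : ∀ x : Space d, ENNReal.ofReal (1 / (k γ : ℝ) *
        Real.exp (inner ℝ s x - cumulantReal f s)) =
        ENNReal.ofReal (1 / (k γ : ℝ) * Real.exp (-cumulantReal f s)) *
          ENNReal.ofReal (Real.exp (inner ℝ s x)) := by
      intro x
      rw [← ENNReal.ofReal_mul (by positivity), mul_assoc, ← Real.exp_add]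
      congr 3
      ring
    simp_rw [h1]
    rw [lintegral_const_mul _ (by fun_prop), lintegral_exp_inner hμ hs,
      ← ENNReal.ofReal_mul (by positivity), mul_assoc, ← Real.exp_add]
    simp
  rw [tiltedLaw_eq hf, withDensity_apply _ MeasurableSet.univ, Measure.restrict_univ]
  have h2 : ∀ x, ENNReal.ofReal (tiltWeight f k a γ x) =
      ∑ i ∈ Finset.Icc 1 (k γ), ENNReal.ofReal (1 / (k γ : ℝ) *
      Real.exp (inner ℝ (tilt f (a γ i)) x - cumulantReal f (tilt f (a γ i)))) := fun x =>
    ENNReal.ofReal_sum_of_nonneg fun i _ => by positivity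
  simp_rw [h2]
  rw [lintegral_finsetSum _ fun i _ => by fun_prop, Finset.sum_congr rfl hterm,
    ← ENNReal.ofReal_sum_of_nonneg fun i _ => by positivity]
  simp [hk0.ne']

theorem expNeg_coe (u : ℝ) : expNeg (u : EReal) = Real.exp (-u) := by
  rw [expNeg, ← EReal.coe_neg, EReal.exp_coe, ENNReal.toReal_ofReal (Real.exp_pos _).le]

theorem expNeg_nonneg (u : EReal) : 0 ≤ expNeg u := ENNReal.toReal_nonneg

theorem expNeg_sub_mul_coe (u : EReal) (hu : u ≠ ⊥) (v : ℝ) :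
    expNeg (u - v) * expNeg v = expNeg u := by
  induction u with
  | bot => exact absurd rfl hu
  | coe u =>
    rw [← EReal.coe_sub, expNeg_coe, expNeg_coe, expNeg_coe, ← Real.exp_add]
    congr 1
    ring
  | top => simp [expNeg]

theorem measurableSet_coveredSet (hE : MeasurableSet (rareSet g γ)) :
    MeasurableSet (coveredSet f g k a γ) := by
  refine hE.inter (Finset.measurableSet_biUnion _ fun i _ => ?_)
  exact measurableSet_le measurable_const (by fun_prop)

theorem measurable_coveredOutput (hf : IsDensity f) (hE : MeasurableSet (rareSet g γ)) :
    Measurable (coveredOutput f g k a γ) :=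
  (hf.measurable.div (hf.measurable.mul measurable_tiltWeight)).indicator
    (measurableSet_coveredSet hE)

theorem coveredOutput_nonneg (hf : IsDensity f) (hk : 1 ≤ k γ) (x : Space d) :
    0 ≤ coveredOutput f g k a γ x :=
  Set.indicator_nonneg (fun x _ => div_nonneg (hf.nonneg x)
    (mul_nonneg (hf.nonneg x) (tiltWeight_pos hk x).le)) x

/-- On the half-space of a dominating point `aᵢ` the `i`-th exponential tilt is at least
`exp (I(aᵢ)) ≥ exp (I(a₁))`, because `I(aᵢ)` is the value at `aᵢ` of its exponent. -/
theorem coveredOutput_le (hf : IsDensity f) (hμ : RegularCumulant f) (hk : 1 ≤ k γ)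
    (ha : ∀ i ∈ Finset.Icc 1 (k γ), a γ i ∈ interior (rateDom f))
    (hord : ∀ i ∈ Finset.Icc 1 (k γ), rate f (a γ 1) ≤ rate f (a γ i)) (x : Space d) :
    coveredOutput f g k a γ x ≤ k γ * expNeg (rate f (a γ 1)) := by
  have hk0 : (0 : ℝ) < k γ := by exact_mod_cast hk
  have hB : 0 ≤ k γ * expNeg (rate f (a γ 1)) := mul_nonneg hk0.le (expNeg_nonneg _)
  refine Set.indicator_apply_le' (fun hx => ?_) fun _ => hB
  rcases (hf.nonneg x).eq_or_lt with hfx | hfx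
  · rw [← hfx, zero_div]
    exact hB
  obtain ⟨i, hi, hxi⟩ := Set.mem_iUnion₂.1 hx.2
  have hrate := hμ.rate_eq hf (ha i hi)
  have h1 := hμ.rate_eq hf (ha 1 (Finset.mem_Icc.2 ⟨le_rfl, hk⟩))
  have hle := hord i hi
  set I₁ := inner ℝ (tilt f (a γ 1)) (a γ 1) - cumulantReal f (tilt f (a γ 1))
  rw [h1, hrate, EReal.coe_le_coe_iff] at hle
  have hw : 1 / (k γ : ℝ) * Real.exp I₁ ≤ tiltWeight f k a γ x := by
    refine le_trans ?_ (Finset.single_le_sum (f := fun i => 1 / (k γ : ℝ) *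
      Real.exp (inner ℝ (tilt f (a γ i)) x - cumulantReal f (tilt f (a γ i))))
      (fun i _ => by positivity) hi)
    refine mul_le_mul_of_nonneg_left (Real.exp_le_exp.2 (hle.trans ?_)) (by positivity)
    have : 0 ≤ inner ℝ (tilt f (a γ i)) (x - a γ i) := hxi
    rw [inner_sub_right] at this
    linarith
  rw [tiltedDensity_eq, h1, expNeg_coe, div_le_iff₀ (mul_pos hfx (tiltWeight_pos hk x))]
  have h2 : k γ * Real.exp (-I₁) * (1 / (k γ : ℝ) * Real.exp I₁) = 1 := by
    rw [Real.exp_neg]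
    field_simp
  have h3 := mul_le_mul_of_nonneg_left hw
    (show 0 ≤ k γ * Real.exp (-I₁) by positivity)
  rw [h2] at h3
  nlinarith [mul_le_mul_of_nonneg_left h3 hfx.le]

theorem integral_coveredOutput (hf : IsDensity f) (hk : 1 ≤ k γ)
    (hE : MeasurableSet (rareSet g γ)) :
    ∫ x, coveredOutput f g k a γ x ∂(tiltedLaw f k a γ) = coveredProb f g k a γ := by
  have hfpos : ∀ᵐ x ∂(densityLaw f), f x ≠ 0 := by
    rw [densityLaw, ae_withDensity_iff hf.measurable.ennreal_ofReal]
    refine Eventually.of_forall fun x hx h0 => hx ?_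
    rw [h0, ENNReal.ofReal_zero]
  rw [tiltedLaw_eq hf, integral_withDensity_eq_integral_toReal_smul
    measurable_tiltWeight.ennreal_ofReal (Eventually.of_forall fun _ => ENNReal.ofReal_lt_top),
    coveredProb, ← integral_indicator_one (measurableSet_coveredSet hE)]
  refine integral_congr_ae ?_
  filter_upwards [hfpos] with x hx
  have hw := tiltWeight_pos (f := f) (a := a) hk x
  rw [ENNReal.toReal_ofReal hw.le, smul_eq_mul, coveredOutput]
  by_cases hxE : x ∈ coveredSet f g k a γ
  · rw [Set.indicator_of_mem hxE, Set.indicator_of_mem hxE, tiltedDensity_eq, Pi.one_apply]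
    field_simp
  · rw [Set.indicator_of_notMem hxE, Set.indicator_of_notMem hxE, mul_zero]

theorem variance_coveredOutput_le (hf : IsDensity f) (hμ : RegularCumulant f) (hk : 1 ≤ k γ)
    (ha : ∀ i ∈ Finset.Icc 1 (k γ), a γ i ∈ interior (rateDom f))
    (hord : ∀ i ∈ Finset.Icc 1 (k γ), rate f (a γ 1) ≤ rate f (a γ i))
    (hE : MeasurableSet (rareSet g γ)) :
    variance (coveredOutput f g k a γ) (tiltedLaw f k a γ) ≤
      (k γ * expNeg (rate f (a γ 1))) ^ 2 := by
  have := isProbabilityMeasure_tiltedLaw hf hμ hk ha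
  have h := variance_le_sq_of_bounded (μ := tiltedLaw f k a γ) (X := coveredOutput f g k a γ)
    (a := 0) (b := k γ * expNeg (rate f (a γ 1)))
    (Eventually.of_forall fun x =>
      ⟨coveredOutput_nonneg hf hk x, coveredOutput_le hf hμ hk ha hord x⟩)
    (measurable_coveredOutput hf hE).aemeasurable
  refine h.trans ?_
  rw [sub_zero, div_pow]
  exact div_le_self (sq_nonneg _) (by norm_num)

theorem prob_eq_add (hf : IsDensity f) (hE : MeasurableSet (rareSet g γ)) :
    prob f g γ = coveredProb f g k a γ + missedProb f g k a γ := by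
  have := hf.isProbabilityMeasure
  rw [prob, coveredProb, missedProb, missedSet,
    measureReal_sdiff (show coveredSet f g k a γ ⊆ rareSet g γ from Set.inter_subset_left)
      (measurableSet_coveredSet hE)]
  ring

/-! ### Coverage of the interval at a fixed level -/

/-- The slack between `log (3 / α)` and `log (4 / α)` in the half-width. -/
theorem halfWidth_add_le {n : ℕ} (hn : 2 ≤ n) {K : ℕ} {u : EReal} {α : ℝ} (hα : 0 < α)
    (z : Fin n → ℝ) :
    √(2 * sampleVariance z * Real.log (3 / α) / n) +
        7 * Real.log (3 / α) * (K * expNeg u) / (3 * (n - 1)) +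
        7 * Real.log (4 / 3) * (K * expNeg u) / (3 * (n - 1)) ≤ halfWidth K u α z := by
  have hn' : (2 : ℝ) ≤ n := by exact_mod_cast hn
  have hlog : Real.log (4 / α) = Real.log (3 / α) + Real.log (4 / 3) := by
    rw [← Real.log_mul (by positivity) (by norm_num)]
    congr 1
    field_simp
  have h43 : 0 ≤ Real.log (4 / 3) := Real.log_nonneg (by norm_num)
  have hV := sampleVariance_nonneg hn z
  have h1 : √(2 * sampleVariance z * Real.log (3 / α) / n) ≤
      √(2 * sampleVariance z * Real.log (4 / α) / n) := by
    refine Real.sqrt_le_sqrt (div_le_div_of_nonneg_right ?_ (by linarith))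
    exact mul_le_mul_of_nonneg_left (by linarith) (by positivity)
  rw [halfWidth, add_assoc, ← add_div]
  refine add_le_add h1 (le_of_eq ?_)
  rw [hlog]
  ring

/-- Up to the event that the sample hits the missed set, the interval fails with probability at
most `α`. Three tail events of probability `α / 3` are used, which gives the logarithm `log (3 / α)`;
the difference to `log (4 / α)` makes room for the bias `p₂`. -/
theorem measure_halfWidth_lt_le (hf : IsDensity f) (hμ : RegularCumulant f) (hk : 1 ≤ k γ)
    (ha : ∀ i ∈ Finset.Icc 1 (k γ), a γ i ∈ interior (rateDom f))
    (hord : ∀ i ∈ Finset.Icc 1 (k γ), rate f (a γ 1) ≤ rate f (a γ i))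
    (hE : MeasurableSet (rareSet g γ)) {n : ℕ} (hn : 2 ≤ n) {Ω : Type*} [MeasurableSpace Ω]
    {Q : Measure Ω} {X : Fin n → Ω → Space d} (hX : iIndepFun X Q)
    (hlaw : ∀ i, HasLaw (X i) (tiltedLaw f k a γ) Q) {α : ℝ} (hα : 0 < α) (hα1 : α < 1)
    (hp₂ : missedProb f g k a γ ≤
      7 * Real.log (4 / 3) * (k γ * expNeg (rate f (a γ 1))) / (3 * (n - 1))) :
    Q {ω | halfWidth (k γ) (rate f (a γ 1)) α (fun i => output f g k a γ (X i ω)) <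
        |sampleMean (fun i => output f g k a γ (X i ω)) - prob f g γ|} ≤
      ENNReal.ofReal α +
        ENNReal.ofReal (n * (tiltedLaw f k a γ).real (missedSet f g k a γ)) := by
  have := isProbabilityMeasure_tiltedLaw hf hμ hk ha
  have hZm := measurable_coveredOutput (k := k) (a := a) hf hE
  set B := k γ * expNeg (rate f (a γ 1)) with hB
  have hk0 : (0 : ℝ) < k γ := by exact_mod_cast hk
  have hB0 : 0 < B := by
    rw [hB, hμ.rate_eq hf (ha 1 (Finset.mem_Icc.2 ⟨le_rfl, hk⟩)), expNeg_coe]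
    positivity
  set ν := (tiltedLaw f k a γ).map (coveredOutput f g k a γ) with hν
  have hνp : IsProbabilityMeasure ν := Measure.isProbabilityMeasure_map hZm.aemeasurable
  have hνB : ∀ᵐ x ∂ν, 0 ≤ x ∧ x ≤ B := by
    rw [hν, ae_map_iff hZm.aemeasurable measurableSet_Icc]
    exact Eventually.of_forall fun x =>
      ⟨coveredOutput_nonneg hf hk x, coveredOutput_le hf hμ hk ha hord x⟩
  have hνp₁ : ∫ y, y ∂ν = coveredProb f g k a γ := by
    rw [hν, integral_map hZm.aemeasurable (by fun_prop), integral_coveredOutput hf hk hE]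
  have hL : 0 ≤ Real.log (3 / α) := Real.log_nonneg (by rw [le_div_iff₀ hα]; linarith)
  have hbern := empirical_bernstein_pi hνB hB0 hL hn
  have hexp : 3 * Real.exp (-Real.log (3 / α)) = α := by
    rw [Real.exp_neg, Real.exp_log (by positivity)]
    field_simp
  rw [hexp, hνp₁] at hbern
  set bad : Set (Fin n → ℝ) := {z | √(2 * sampleVariance z * Real.log (3 / α) / n) +
    7 * Real.log (3 / α) * B / (3 * (n - 1)) < |sampleMean z - coveredProb f g k a γ|} with hbad
  have hXm : ∀ i, AEMeasurable (fun ω => coveredOutput f g k a γ (X i ω)) Q := fun i =>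
    hZm.comp_aemeasurable (hlaw i).aemeasurable
  have hmap : Q.map (fun ω i => coveredOutput f g k a γ (X i ω)) = Measure.pi fun _ => ν := by
    rw [(hX.comp (fun _ => coveredOutput f g k a γ) fun _ => hZm).map_fun_eq_pi_map hXm]
    congr 1
    ext1 i
    rw [hν, ← (hlaw i).map_eq, AEMeasurable.map_map_of_aemeasurable hZm.aemeasurable
      (hlaw i).aemeasurable]
    rfl
  have hgood : Q ((fun ω i => coveredOutput f g k a γ (X i ω)) ⁻¹' bad) ≤ ENNReal.ofReal α := by
    refine (Measure.le_map_apply (aemeasurable_pi_lambda _ hXm) bad).trans ?_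
    rw [hmap, ← ofReal_measureReal]
    exact ENNReal.ofReal_le_ofReal hbern
  have hmiss : Q (⋃ i, X i ⁻¹' missedSet f g k a γ) ≤
      ENNReal.ofReal (n * (tiltedLaw f k a γ).real (missedSet f g k a γ)) := by
    refine (measure_iUnion_fintype_le Q _).trans ?_
    have h1 : ∀ i, Q (X i ⁻¹' missedSet f g k a γ) ≤ tiltedLaw f k a γ (missedSet f g k a γ) :=
      fun i => by
        have := Measure.le_map_apply (hlaw i).aemeasurable (missedSet f g k a γ)
        rwa [(hlaw i).map_eq] at this
    refine (Finset.sum_le_sum fun i _ => h1 i).trans (le_of_eq ?_)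
    rw [ENNReal.ofReal_mul (Nat.cast_nonneg n), ofReal_measureReal]
    simp
  refine le_trans (measure_mono fun ω hω => ?_) ((measure_union_le _ _).trans
    (add_le_add hgood hmiss))
  by_cases hmem : ω ∈ ⋃ i, X i ⁻¹' missedSet f g k a γ
  · exact Or.inr hmem
  refine Or.inl ?_
  have hsame : ∀ i, output f g k a γ (X i ω) = coveredOutput f g k a γ (X i ω) := by
    intro i
    have hi : X i ω ∉ missedSet f g k a γ := fun h => hmem (Set.mem_iUnion.2 ⟨i, h⟩)
    rw [output, coveredOutput]
    by_cases hr : X i ω ∈ coveredSet f g k a γ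
    · rw [Set.indicator_of_mem hr, Set.indicator_of_mem hr.1]
    · have : X i ω ∉ rareSet g γ := fun h => hi ⟨h, hr⟩
      rw [Set.indicator_of_notMem hr, Set.indicator_of_notMem this]
  simp only [hsame, Set.mem_ofPred_eq] at hω
  set z : Fin n → ℝ := fun i => coveredOutput f g k a γ (X i ω)
  have h1 := halfWidth_add_le (K := k γ) (u := rate f (a γ 1)) hn hα z
  have h2 : |sampleMean z - prob f g γ| ≤
      |sampleMean z - coveredProb f g k a γ| + missedProb f g k a γ := by
    rw [prob_eq_add (k := k) (a := a) hf hE, ← sub_sub]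
    refine (abs_sub _ _).trans (le_of_eq ?_)
    rw [abs_of_nonneg (show 0 ≤ missedProb f g k a γ from measureReal_nonneg)]
  change √(2 * sampleVariance z * Real.log (3 / α) / n) +
    7 * Real.log (3 / α) * B / (3 * (n - 1)) < |sampleMean z - coveredProb f g k a γ|
  linarith

end FixedLevel

/-! ### Growth in `-log p` -/

section Asymptotics

theorem eventually_le_exp_of_tendsto_log_div {n : ℝ → ℕ} {ℓ : ℝ → ℝ}
    (hℓ : Tendsto ℓ atTop atTop) (hn : ∀ᶠ γ in atTop, 2 ≤ n γ)
    (h : Tendsto (fun γ => Real.log (n γ) / ℓ γ) atTop (𝓝 0)) {ε : ℝ} (hε : 0 < ε) :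
    ∀ᶠ γ in atTop, (n γ : ℝ) ≤ Real.exp (ε * ℓ γ) := by
  filter_upwards [h.eventually (gt_mem_nhds hε), hℓ.eventually_gt_atTop 0, hn] with γ h1 h2 h3
  have hn0 : (0 : ℝ) < n γ := by
    have : 0 < n γ := by omega
    exact_mod_cast this
  rw [← Real.log_le_iff_le_exp hn0]
  exact ((div_lt_iff₀ h2).1 h1).le

theorem tendsto_log_div_of_eventually_le_exp {n : ℝ → ℕ} {ℓ : ℝ → ℝ}
    (hℓ : Tendsto ℓ atTop atTop) (hn : ∀ᶠ γ in atTop, 2 ≤ n γ)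
    (h : ∀ ε > 0, ∀ᶠ γ in atTop, (n γ : ℝ) ≤ Real.exp (ε * ℓ γ)) :
    Tendsto (fun γ => Real.log (n γ) / ℓ γ) atTop (𝓝 0) := by
  refine tendsto_order.2 ⟨fun b hb => ?_, fun b hb => ?_⟩
  · filter_upwards [hℓ.eventually_gt_atTop 0, hn] with γ h2 h3
    have : (1 : ℝ) ≤ n γ := by
      have : 1 ≤ n γ := by omega
      exact_mod_cast this
    exact hb.trans_le (div_nonneg (Real.log_nonneg this) h2.le)
  · filter_upwards [hℓ.eventually_gt_atTop 0, hn, h (b / 2) (by linarith)] with γ h2 h3 h4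
    have hn0 : (0 : ℝ) < n γ := by
      have : 0 < n γ := by omega
      exact_mod_cast this
    rw [div_lt_iff₀ h2]
    have := (Real.log_le_iff_le_exp hn0).2 h4
    nlinarith

theorem eventually_const_mul_exp_le {ℓ : ℝ → ℝ} (hℓ : Tendsto ℓ atTop atTop) (C : ℝ) {c D : ℝ}
    (hc : 0 < c) (hD : 0 < D) : ∀ᶠ γ in atTop, C * Real.exp (-c * ℓ γ) ≤ D := by
  have h1 : Tendsto (fun γ => Real.exp (-c * ℓ γ)) atTop (𝓝 0) :=
    Real.tendsto_exp_atBot.comp (hℓ.const_mul_atTop_of_neg (neg_lt_zero.2 hc))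
  have h2 := h1.const_mul C
  rw [mul_zero] at h2
  exact (h2.eventually (gt_mem_nhds hD)).mono fun γ h => h.le

variable {d : ℕ} {f g : Space d → ℝ} {r k : ℝ → ℕ} {a : ℝ → ℕ → Space d}

theorem tendsto_neg_log_prob (hf : IsDensity f) (hp : ProblemAssumption f g r a)
    (hneg : NegligibleAssumption f g r k a) :
    Tendsto (fun γ => -Real.log (prob f g γ)) atTop atTop := by
  have := hf.isProbabilityMeasure
  have hpos : ∀ᶠ γ in atTop, prob f g γ ∈ Set.Ioi (0 : ℝ) := by
    filter_upwards [hneg.covered.1] with γ h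
    exact h.1.trans_le (measureReal_mono Set.inter_subset_left)
  have h0 : Tendsto (prob f g) atTop (𝓝[>] 0) :=
    tendsto_nhdsWithin_iff.2 ⟨hp.rare, hpos⟩
  exact tendsto_neg_atBot_atTop.comp (Real.tendsto_log_nhdsGT_zero.comp h0)

theorem eventually_dominating_points (hp : ProblemAssumption f g r a)
    (hk : ∀ᶠ γ in atTop, 1 ≤ k γ ∧ k γ ≤ r γ) :
    ∀ᶠ γ in atTop, (∀ i ∈ Finset.Icc 1 (k γ), a γ i ∈ interior (rateDom f)) ∧
      ∀ i ∈ Finset.Icc 1 (k γ), rate f (a γ 1) ≤ rate f (a γ i) := by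
  filter_upwards [hp.dominating, hp.ordered, hk] with γ h1 h2 h3
  refine ⟨fun i hi => ?_, fun i hi => ?_⟩
  · rw [Finset.mem_Icc] at hi
    exact h1.subset_interior ⟨i, ⟨hi.1, hi.2.trans h3.2⟩, rfl⟩
  · rw [Finset.mem_Icc] at hi
    exact h2 1 i le_rfl hi.1 (hi.2.trans h3.2)

/-! ### Admissible sample sizes and negligible terms -/

theorem exists_admissibleSampleSize (hf : IsDensity f) (hp : ProblemAssumption f g r a)
    (hk : ∀ᶠ γ in atTop, 1 ≤ k γ ∧ k γ ≤ r γ) (hneg : NegligibleAssumption f g r k a) :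
    ∃ n : ℝ → ℕ, AdmissibleSampleSize f g k a n := by
  set ℓ : ℝ → ℝ := fun γ => -Real.log (prob f g γ) with hℓ_def
  have hℓ : Tendsto ℓ atTop atTop := tendsto_neg_log_prob hf hp hneg
  set R : ℝ → ℝ := fun γ => k γ * expNeg (rate f (a γ 1)) / coveredProb f g k a γ with hR
  -- The variance of `Z₁` is at most `R² p₁²`, so `n = R² ℓ` is enough.
  let n : ℝ → ℕ := fun γ => ⌈R γ ^ 2 * ℓ γ⌉₊ + 2
  have hn2 : ∀ γ, 2 ≤ n γ := fun γ => Nat.le_add_left _ _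
  refine ⟨n, Eventually.of_forall hn2,
    tendsto_log_div_of_eventually_le_exp hℓ (Eventually.of_forall hn2) fun ε hε => ?_, ?_⟩
  · set δ := ε / 6 with hδ_def
    have hδ : 0 < δ := by positivity
    have hexp : Tendsto (fun γ => Real.exp (δ * ℓ γ)) atTop atTop :=
      Real.tendsto_exp_atTop.comp (hℓ.const_mul_atTop hδ)
    have hid : ∀ᶠ γ in atTop, ℓ γ ≤ Real.exp (δ * ℓ γ) := by
      have h1 := (Real.tendsto_exp_div_pow_atTop 1).comp (hℓ.const_mul_atTop hδ)
      filter_upwards [h1.eventually_ge_atTop (1 / δ), hℓ.eventually_gt_atTop 0] with γ h2 h3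
      simp only [Function.comp_apply, pow_one] at h2
      rw [le_div_iff₀ (mul_pos hδ h3)] at h2
      calc ℓ γ = 1 / δ * (δ * ℓ γ) := by field_simp
        _ ≤ _ := h2
    filter_upwards [hp.subexp δ hδ, hneg.covered.2.eventually (lt_mem_nhds (neg_lt_zero.2 hδ)),
      hneg.covered.1, hk, hid, hexp.eventually_ge_atTop 4, hℓ.eventually_gt_atTop 0]
      with γ hr hc hpos hkr hid h4 hℓ0
    set E := Real.exp (δ * ℓ γ) with hE
    have hkE : (k γ : ℝ) ≤ E := le_trans (by exact_mod_cast hkr.2) hr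
    have hcE : expNeg (rate f (a γ 1)) / coveredProb f g k a γ ≤ E := by
      rw [lt_div_iff₀ hℓ0] at hc
      rw [← Real.log_le_iff_le_exp (div_pos hpos.2 hpos.1), ← inv_div, Real.log_inv]
      change -δ * ℓ γ < _ at hc
      linarith
    have hc0 : 0 ≤ expNeg (rate f (a γ 1)) / coveredProb f g k a γ :=
      (div_pos hpos.2 hpos.1).le
    have hRE : R γ ≤ E * E := by
      simp only [hR]
      rw [mul_div_assoc]
      exact mul_le_mul hkE hcE hc0 (Real.exp_pos _).le
    have hR0 : 0 ≤ R γ := by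
      simp only [hR]
      rw [mul_div_assoc]
      positivity
    have hceil : (n γ : ℝ) ≤ R γ ^ 2 * ℓ γ + 3 := by
      have := Nat.ceil_lt_add_one (show 0 ≤ R γ ^ 2 * ℓ γ by positivity)
      simp only [n]
      push_cast
      linarith
    have hE1 : (1 : ℝ) ≤ E := by linarith
    have h5 : R γ ^ 2 * ℓ γ ≤ E ^ 5 := by
      calc R γ ^ 2 * ℓ γ ≤ (E * E) ^ 2 * E :=
            mul_le_mul (pow_le_pow_left₀ hR0 hRE 2) hid hℓ0.le (by positivity)
        _ = E ^ 5 := by ring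
    have h6 : Real.exp (ε * ℓ γ) = E ^ 5 * E := by
      rw [hE, ← pow_succ, ← Real.exp_nat_mul]
      congr 1
      rw [hδ_def]
      push_cast
      ring
    rw [h6]
    have h7 : 1 ≤ E ^ 5 := one_le_pow₀ hE1
    nlinarith
  · refine squeeze_zero' ?_ ?_ (tendsto_inv_atTop_zero.comp hℓ)
    · exact Eventually.of_forall fun γ => div_nonneg (variance_nonneg _ _) (by positivity)
    · filter_upwards [eventually_dominating_points hp hk, hk, hneg.covered.1, hp.closed,
        hℓ.eventually_gt_atTop 0] with γ hdom hkr hpos hcl hℓ0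
      have hv := variance_coveredOutput_le hf hp.regular hkr.1 hdom.1 hdom.2 hcl.measurableSet
      have hn : R γ ^ 2 * ℓ γ ≤ n γ := by
        refine (Nat.le_ceil _).trans ?_
        simp only [n]
        push_cast
        linarith
      have hn0 : (0 : ℝ) < n γ := by
        have : 0 < n γ := by have := hn2 γ; omega
        exact_mod_cast this
      have hp₁ := hpos.1
      rw [Function.comp_apply, div_le_iff₀ (by positivity), inv_mul_eq_div, le_div_iff₀ hℓ0]
      have h8 : R γ ^ 2 * coveredProb f g k a γ ^ 2 =
          (k γ * expNeg (rate f (a γ 1))) ^ 2 := by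
        rw [← mul_pow]
        simp only [hR]
        rw [div_mul_cancel₀ _ hp₁.ne']
      calc _ ≤ (k γ * expNeg (rate f (a γ 1))) ^ 2 * ℓ γ := mul_le_mul_of_nonneg_right hv hℓ0.le
        _ = R γ ^ 2 * ℓ γ * coveredProb f g k a γ ^ 2 := by rw [← h8]; ring
        _ ≤ n γ * coveredProb f g k a γ ^ 2 := mul_le_mul_of_nonneg_right hn (sq_nonneg _)

/-- The bias `p₂` of the estimator of `p₁` is negligible against the second summand of the
half-width. -/
theorem eventually_missedProb_le (hf : IsDensity f) (hp : ProblemAssumption f g r a)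
    (hk : ∀ᶠ γ in atTop, 1 ≤ k γ ∧ k γ ≤ r γ) (hneg : NegligibleAssumption f g r k a)
    {n : ℝ → ℕ} (hn : AdmissibleSampleSize f g k a n) :
    ∀ᶠ γ in atTop, missedProb f g k a γ ≤
      7 * Real.log (4 / 3) * (k γ * expNeg (rate f (a γ 1))) / (3 * ((n γ : ℝ) - 1)) := by
  set ℓ : ℝ → ℝ := fun γ => -Real.log (prob f g γ) with hℓ_def
  have hℓ : Tendsto ℓ atTop atTop := tendsto_neg_log_prob hf hp hneg
  obtain ⟨h, hh, hmissed⟩ := hneg.missed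
  obtain ⟨C, hC, c, hc, hgap⟩ := hneg.gap
  have h43 : 0 < 7 * Real.log (4 / 3) / 3 := by
    have := Real.log_pos (show (1 : ℝ) < 4 / 3 by norm_num)
    positivity
  filter_upwards [hh (c / 4) (by positivity), hmissed, hgap,
    eventually_le_exp_of_tendsto_log_div hℓ hn.two_le hn.subexp (ε := c / 4) (by positivity),
    eventually_const_mul_exp_le hℓ C (c := c / 2) (by positivity) h43, hn.two_le, hk,
    eventually_dominating_points hp hk] with γ h1 h2 h3 h4 h5 h6 h7 h8
  have hn' : (2 : ℝ) ≤ n γ := by exact_mod_cast h6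
  have hk1 : (1 : ℝ) ≤ k γ := by exact_mod_cast h7.1
  have hI := hp.regular.rate_eq hf (h8.1 1 (Finset.mem_Icc.2 ⟨le_rfl, h7.1⟩))
  set e₁ := expNeg (rate f (a γ 1)) with he₁
  have he₁0 : 0 ≤ e₁ := expNeg_nonneg _
  have hnext : expNeg (nextRate f r k a γ) ≤ C * Real.exp (-c * ℓ γ) * e₁ := by
    have hbot : nextRate f r k a γ ≠ ⊥ := by
      rw [nextRate]
      split_ifs
      · exact ((EReal.bot_lt_zero).trans_le (rate_nonneg hf _)).ne'
      · exact top_ne_bot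
    have hsplit := expNeg_sub_mul_coe (nextRate f r k a γ) hbot
      (inner ℝ (tilt f (a γ 1)) (a γ 1) - cumulantReal f (tilt f (a γ 1)))
    rw [← hI] at hsplit
    rw [← hsplit]
    exact mul_le_mul_of_nonneg_right h3 he₁0
  have hp₂ : missedProb f g k a γ ≤
      Real.exp (c / 4 * ℓ γ) * (C * Real.exp (-c * ℓ γ) * e₁) :=
    h2.trans ((mul_le_mul_of_nonneg_right h1 (expNeg_nonneg _)).trans
      (mul_le_mul_of_nonneg_left hnext (Real.exp_pos _).le))
  rw [le_div_iff₀ (by linarith)]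
  have hp₂0 : 0 ≤ missedProb f g k a γ := measureReal_nonneg
  have hexp : Real.exp (c / 4 * ℓ γ) * Real.exp (-c * ℓ γ) * Real.exp (c / 4 * ℓ γ) =
      Real.exp (-(c / 2) * ℓ γ) := by
    rw [← Real.exp_add, ← Real.exp_add]
    congr 1
    ring
  calc missedProb f g k a γ * (3 * ((n γ : ℝ) - 1))
      ≤ missedProb f g k a γ * (3 * Real.exp (c / 4 * ℓ γ)) :=
        mul_le_mul_of_nonneg_left (by linarith) hp₂0
    _ ≤ Real.exp (c / 4 * ℓ γ) * (C * Real.exp (-c * ℓ γ) * e₁) *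
          (3 * Real.exp (c / 4 * ℓ γ)) := mul_le_mul_of_nonneg_right hp₂ (by positivity)
    _ = 3 * (C * Real.exp (-(c / 2) * ℓ γ)) * e₁ := by rw [← hexp]; ring
    _ ≤ 3 * (7 * Real.log (4 / 3) / 3) * e₁ :=
        mul_le_mul_of_nonneg_right (mul_le_mul_of_nonneg_left h5 (by norm_num)) he₁0
    _ = 7 * Real.log (4 / 3) * (1 * e₁) := by ring
    _ ≤ 7 * Real.log (4 / 3) * (k γ * e₁) :=
        mul_le_mul_of_nonneg_left (mul_le_mul_of_nonneg_right hk1 he₁0) (by linarith)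

/-- The bound of the union bound for the event that the sample hits the missed set tends to `0`. -/
theorem tendsto_sampleSize_mul_missed (hf : IsDensity f) (hp : ProblemAssumption f g r a)
    (hneg : NegligibleAssumption f g r k a) (htilt : MissedTiltedDecay f g k a)
    {n : ℝ → ℕ} (hn : AdmissibleSampleSize f g k a n) :
    Tendsto (fun γ => n γ * (tiltedLaw f k a γ).real (missedSet f g k a γ)) atTop (𝓝 0) := by
  set ℓ : ℝ → ℝ := fun γ => -Real.log (prob f g γ) with hℓ_def
  have hℓ : Tendsto ℓ atTop atTop := tendsto_neg_log_prob hf hp hneg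
  obtain ⟨C, hC, c, hc, hdecay⟩ := htilt
  refine tendsto_order.2 ⟨fun b hb => Eventually.of_forall fun γ => hb.trans_le (by positivity),
    fun b hb => ?_⟩
  filter_upwards [hdecay,
    eventually_le_exp_of_tendsto_log_div hℓ hn.two_le hn.subexp (ε := c / 2) (by positivity),
    eventually_const_mul_exp_le hℓ C (c := c / 2) (by positivity) (half_pos hb)] with γ h1 h2 h3
  have hexp : Real.exp (c / 2 * ℓ γ) * Real.exp (-c * ℓ γ) = Real.exp (-(c / 2) * ℓ γ) := by
    rw [← Real.exp_add]
    congr 1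
    ring
  calc n γ * (tiltedLaw f k a γ).real (missedSet f g k a γ)
      ≤ Real.exp (c / 2 * ℓ γ) * (C * Real.exp (-c * ℓ γ)) :=
        mul_le_mul h2 h1 measureReal_nonneg (Real.exp_pos _).le
    _ = C * Real.exp (-(c / 2) * ℓ γ) := by rw [← hexp]; ring
    _ ≤ b / 2 := h3
    _ < b := half_lt_self hb

end Asymptotics

end RareEvent

open RareEvent
theorem mainTheorem4 {d : ℕ} (f g : Space d → ℝ) (hf : IsDensity f)
    (r k : ℝ → ℕ) (a : ℝ → ℕ → Space d)
    (hproblem : ProblemAssumption f g r a)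
    (hk : ∀ᶠ γ in atTop, 1 ≤ k γ ∧ k γ ≤ r γ)
    (hneg : NegligibleAssumption f g r k a)
    (htilt : MissedTiltedDecay f g k a) :
    (∃ n : ℝ → ℕ, AdmissibleSampleSize f g k a n) ∧
    ∀ n : ℝ → ℕ, AdmissibleSampleSize f g k a n →
      ∀ (Ω : ℝ → Type*) [∀ γ, MeasurableSpace (Ω γ)] (Q : ∀ γ, Measure (Ω γ))
        [∀ γ, IsProbabilityMeasure (Q γ)] (X : ∀ γ, Fin (n γ) → Ω γ → Space d),
        (∀ᶠ γ in atTop, iIndepFun (X γ) (Q γ) ∧ ∀ i, HasLaw (X γ i) (tiltedLaw f k a γ) (Q γ)) →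
        ∀ α : ℝ, 0 < α → α < 1 →
          limsup (fun γ => Q γ {ω |
              halfWidth (k γ) (rate f (a γ 1)) α (fun i => output f g k a γ (X γ i ω)) <
                |sampleMean (fun i => output f g k a γ (X γ i ω)) - prob f g γ|}) atTop
            ≤ ENNReal.ofReal α := by
  refine ⟨exists_admissibleSampleSize hf hproblem hk hneg, ?_⟩
  intro n hn Ω _ Q _ X hX α hα hα1
  have hlim : Tendsto (fun γ => ENNReal.ofReal α +
      ENNReal.ofReal (n γ * (tiltedLaw f k a γ).real (missedSet f g k a γ))) atTop
      (𝓝 (ENNReal.ofReal α)) := by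
    have h := ENNReal.tendsto_ofReal (tendsto_sampleSize_mul_missed hf hproblem hneg htilt hn)
    simpa using h.const_add (ENNReal.ofReal α)
  rw [← hlim.limsup_eq]
  refine limsup_le_limsup ?_
  filter_upwards [eventually_dominating_points hproblem hk, hk, hproblem.closed, hn.two_le, hX,
    eventually_missedProb_le hf hproblem hk hneg hn] with γ hdom hkr hcl hn2 hXγ hp₂
  exact measure_halfWidth_lt_le hf hproblem.regular hkr.1 hdom.1 hdom.2 hcl.measurableSet hn2
    hXγ.1 hXγ.2 hα hα1 hp₂
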